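/- Work over $\mathbb{C}$, in the analytic category. Let $\mathbb{P}^{1|2}$ be the projective superspace with charts $(z\,|\,\theta_1,\theta_2)$ and $(w\,|\,\theta'_1,\theta'_2)$, where $w=1/z$ and $\theta'_i=\theta_i/z$, structure sheaf $\mathcal{O}$ and tangent sheaf $\mathcal{T}$. For $k\in\mathbb{Z}$ and $p\in\{0,1,2\}$ let $\Omega^{k;p}$ be the sheaf of $\mathcal{O}$-modules that is in each chart the direct sum of copies of $\mathcal{O}$ on the formal generators $dz^{\epsilon}u_1u_2$ of degree $k$ and picture number $p$. Here $\epsilon\in\{0,1\}$, and each $u_i$ is either a power $d\theta_i^{a}$ with $a\in\mathbb{Z}$ (degree $a$, picture number $0$) or a delta derivative $\delta^{(l)}(d\theta_i)$ with $l\ge 0$ (degree $-l$, picture number $1$); $dz$ has degree $1$ and picture number $0$; $dz$ and each $\delta^{(l)}(d\theta_i)$ are odd, and $d\theta_i$ is even. The transition functions come from $dz=-w^{-2}dw$ and $d\theta_i=w^{-1}(d\theta'_i-w^{-1}\theta'_i\,dw)$, together with $\delta^{(l)}(d\theta'/w)=w^{l+1}\delta^{(l)}(d\theta')$ and $u(d\theta'_i-w^{-1}\theta'_i\,dw)=u(d\theta'_i)-w^{-1}\theta'_i\,dw\,u'(d\theta'_i)$.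 Thus $\Omega^{k;2}$ is the sheaf of integral forms of degree $k$ (it is zero for $k\ge 2$) and $\Omega^{k;0}$ is the extended superform sheaf. Let $\Theta_i:\Omega^{k;p}\to\Omega^{k-1;p-1}$ and $\eta_i:\Omega^{k;p}\to\Omega^{k+1;p+1}$ be the $\mathcal{O}$-linear morphisms (for $\mathcal{O}$ acting on the left, with no sign for passing the other symbols) that act in each chart on the symbol $u_i$ by $$\Theta_i:\ \delta^{(l)}(d\theta_i)\mapsto\frac{(-1)^l\,l!}{d\theta_i^{\,l+1}}\ (l\ge0),\qquad d\theta_i^{a}\mapsto 0\ (a\in\mathbb{Z}),$$ $$\eta_i:\ \frac{1}{d\theta_i^{\,l+1}}\mapsto\frac{(-1)^l}{l!}\,\delta^{(l)}(d\theta_i)\ (l\ge0),\qquad d\theta_i^{a}\mapsto0\ (a\ge0),\qquad \delta^{(l)}(d\theta_i)\mapsto 0 .$$ For $k\in\mathbb{Z}$ put $\Theta_{\max}=\Theta_2\circ\Theta_1:\Omega^{k;2}\to\Omega^{k-2;0}$ and $\eta_{\max}=\eta_1\circ\eta_2:\Omega^{k-2;0}\to\Omega^{k;2}$. Then the following hold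 for every $k\in\mathbb{Z}$. 1. If $k\le1$, then $\Omega^{k;2}$ is locally free of rank $(1-k)\,|\,(2-k)$, and there is an even isomorphism $\Phi:\Pi\,\mathrm{Sym}^{|k-1|}\Pi\mathcal{T}\cong\Omega^{k;2}$ that sends, in each chart, the generator $(\pi\partial_{\theta_1})^{l_1}(\pi\partial_{\theta_2})^{l_2}$ to a multiple of $dz\,\delta^{(l_1)}(d\theta_1)\delta^{(l_2)}(d\theta_2)$ and $(\pi\partial_z)(\pi\partial_{\theta_1})^{l_1}(\pi\partial_{\theta_2})^{l_2}$ to a multiple of $\delta^{(l_1)}(d\theta_1)\delta^{(l_2)}(d\theta_2)$, the multiples being by nonzero constants that depend only on the chart and on which of the two types the generator has. In particular $\Theta_{\max}\circ\Phi$ injects $\Pi\,\mathrm{Sym}^{|k-1|}\Pi\mathcal{T}$ into $\Omega^{k-2;0}$. 2. $\Omega^{k-2;0}$ is not of finite type at any point of $\mathbb{P}^1$. 3. $\Theta_{\max}$ is an even morphism of sheaves, injective and not surjective. 4. $\eta_{\max}$ is an even morphism of sheaves, surjective onto $\Omega^{k;2}$ and not injective. 5. $\Theta_{\max}\circ\eta_{\max}\circ\Theta_{\max}=\Theta_{\max}$.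 6. $\operatorname{coker}\Theta_{\max}\cong\ker\eta_{\max}$, through the composite $\ker\eta_{\max}\hookrightarrow\Omega^{k-2;0}\twoheadrightarrow\operatorname{coker}\Theta_{\max}$. -/

import Mathlib

open CategoryTheory CategoryTheory.Limits Opposite TopologicalSpace Topology
open scoped LinearAlgebra.Projectivization

noncomputable section

namespace SuperP12

/-! ### The projective line, its two standard charts, and superfunctions -/

/-- The complex projective line, with the quotient topology coming from `ℂ² ∖ {0}`. -/
def P1 : TopCat.{0} :=
  @TopCat.of (ℙ ℂ (Fin 2 → ℂ)) (TopologicalSpace.coinduced (Projectivization.mk' ℂ) inferInstance)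

/-- Chart points: `(0, z)` is the point with coordinate `z` of the chart `U₀`, and `(1, w)` is the
point with coordinate `w` of the chart `U₁`. -/
abbrev ChartPt : Type := Fin 2 × ℂ

/-- The affine coordinates: `(0, z) ↦ [1 : z]` and `(1, w) ↦ [w : 1]`. On the overlap `z = 1 / w`.
-/
def pt : ChartPt → P1
  | (0, z) => Projectivization.mk ℂ ![1, z] (fun e => one_ne_zero (congrFun e 0))
  | (1, w) => Projectivization.mk ℂ ![w, 1] (fun e => one_ne_zero (congrFun e 1))

/-- The chart points that lie over an open subset `U` of the projective line. -/
abbrev Pts (U : Opens P1) : Type := {y : ChartPt // pt y ∈ U}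

/-- Restriction of chart points. -/
def Pts.incl {V U : Opens P1} (h : V ≤ U) (y : Pts V) : Pts U := ⟨y.1, h y.2⟩

/-- The Grassmann algebra `Λ[θ₁, θ₂]` over `ℂ`. -/
abbrev Gr : Type := ExteriorAlgebra ℂ (Fin 2 → ℂ)

/-- The odd generators `θ₁, θ₂`. -/
def theta (i : Fin 2) : Gr := ExteriorAlgebra.ι ℂ (Pi.single i 1)

/-- The constants `ℂ ⊆ Λ[θ₁, θ₂]`. -/
abbrev cst : ℂ →+* Gr := algebraMap ℂ Gr

/-- The homogeneous part of `Λ[θ₁, θ₂]` of a given parity. -/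
def grPart (q : ZMod 2) : Submodule ℂ Gr :=
  CliffordAlgebra.evenOdd (0 : QuadraticForm ℂ (Fin 2 → ℂ)) q

/-- The parity automorphism of `Λ[θ₁, θ₂]`, `θᵢ ↦ -θᵢ`. -/
def grInvol : Gr →ₐ[ℂ] Gr := ExteriorAlgebra.map (-LinearMap.id)

/-- The change of the odd coordinates over a point of `U₀ ∩ U₁` with coordinate `w` in `U₁`: the odd
coordinates of `U₀` are `θᵢ / w` in terms of those of `U₁`. -/
def scale (w : ℂ) : Gr →ₐ[ℂ] Gr := ExteriorAlgebra.map (w⁻¹ • LinearMap.id)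

/-- A function of one complex variable with values in `Λ[θ₁, θ₂]` is holomorphic near `z₀`: all of
its coefficients are. -/
def HoloAt (F : ℂ → Gr) (z₀ : ℂ) : Prop :=
  ∀ φ : Module.Dual ℂ Gr, AnalyticAt ℂ (fun z => φ (F z)) z₀

theorem HoloAt.mul {F G : ℂ → Gr} {z₀ : ℂ} (hF : HoloAt F z₀) (hG : HoloAt G z₀) :
    HoloAt (fun z => F z * G z) z₀ := by
  intro φ
  let b := (Pi.basisFun ℂ (Fin 2)).ExteriorAlgebra
  have key : ∀ z, φ (F z * G z) =
      ∑ I, ∑ J, b.coord I (F z) * b.coord J (G z) * φ (b I * b J) := by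
    intro z
    conv_lhs => rw [← b.sum_repr (F z), ← b.sum_repr (G z)]
    simp only [Finset.sum_mul, Finset.mul_sum, map_sum, smul_mul_assoc, mul_smul_comm, map_smul,
      smul_eq_mul, Module.Basis.coord_apply]
    rw [Finset.sum_comm]
    refine Finset.sum_congr rfl fun I _ => Finset.sum_congr rfl fun J _ => ?_
    ring
  simp only [key]
  refine Finset.analyticAt_fun_sum _ fun I _ => Finset.analyticAt_fun_sum _ fun J _ => ?_
  exact ((hF _).mul (hG _)).mul analyticAt_const

theorem HoloAt.add {F G : ℂ → Gr} {z₀ : ℂ} (hF : HoloAt F z₀) (hG : HoloAt G z₀) :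
    HoloAt (fun z => F z + G z) z₀ := by
  intro φ
  simp only [map_add]
  exact (hF φ).add (hG φ)

theorem HoloAt.const (a : Gr) (z₀ : ℂ) : HoloAt (fun _ => a) z₀ := fun _ => analyticAt_const

/-- A family of elements of `Λ[θ₁, θ₂]`, indexed by the chart points over `U`, is holomorphic: near
every chart point it agrees with a holomorphic function of the coordinate. -/
def IsHolo {U : Opens P1} (s : Pts U → Gr) : Prop :=
  ∀ y : Pts U, ∃ F : ℂ → Gr, HoloAt F y.1.2 ∧
    ∀ᶠ z in 𝓝 y.1.2, ∀ h : pt (y.1.1, z) ∈ U, s ⟨(y.1.1, z), h⟩ = F z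

theorem IsHolo.const {U : Opens P1} (a : Gr) : IsHolo (U := U) (fun _ => a) :=
  fun _ => ⟨fun _ => a, HoloAt.const _ _, Filter.Eventually.of_forall fun _ _ => rfl⟩

theorem IsHolo.add {U : Opens P1} {s t : Pts U → Gr} (hs : IsHolo s) (ht : IsHolo t) :
    IsHolo (fun y => s y + t y) := by
  intro y
  obtain ⟨F, hF, eF⟩ := hs y
  obtain ⟨G, hG, eG⟩ := ht y
  refine ⟨_, hF.add hG, ?_⟩
  filter_upwards [eF, eG] with z h1 h2 h
  rw [h1 h, h2 h]

theorem IsHolo.mul {U : Opens P1} {s t : Pts U → Gr} (hs : IsHolo s) (ht : IsHolo t) :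
    IsHolo (fun y => s y * t y) := by
  intro y
  obtain ⟨F, hF, eF⟩ := hs y
  obtain ⟨G, hG, eG⟩ := ht y
  refine ⟨_, hF.mul hG, ?_⟩
  filter_upwards [eF, eG] with z h1 h2 h
  rw [h1 h, h2 h]

theorem IsHolo.neg {U : Opens P1} {s : Pts U → Gr} (hs : IsHolo s) : IsHolo (fun y => -s y) := by
  simpa using (IsHolo.const (U := U) (-1)).mul hs

theorem IsHolo.sum {U : Opens P1} {κ : Type} (T : Finset κ) {s : κ → Pts U → Gr}
    (hs : ∀ k ∈ T, IsHolo (s k)) : IsHolo (fun y => ∑ k ∈ T, s k y) := by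
  classical
  induction T using Finset.induction_on with
  | empty => simpa using IsHolo.const (U := U) 0
  | insert a T ha ih =>
    simp only [Finset.sum_insert ha]
    exact (hs a (Finset.mem_insert_self a T)).add
      (ih fun k hk => hs k (Finset.mem_insert_of_mem hk))

/-- The ring of superfunctions on `U`: a holomorphic superfunction in each of the two charts, such
that the two agree on the overlap under `z = 1 / w`, `θᵢ⁽⁰⁾ = θᵢ⁽¹⁾ / w`. -/
def OSec (U : Opens P1) : Subring (Pts U → Gr) where
  carrier := {f | IsHolo f ∧ ∀ y₀ y₁ : Pts U, y₀.1.1 = 0 → y₁.1.1 = 1 → y₀.1.2 * y₁.1.2 = 1 →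
    f y₁ = scale y₁.1.2 (f y₀)}
  mul_mem' := by
    rintro f g ⟨hf, hf'⟩ ⟨hg, hg'⟩
    refine ⟨hf.mul hg, fun y₀ y₁ h₀ h₁ h => ?_⟩
    simp [hf' y₀ y₁ h₀ h₁ h, hg' y₀ y₁ h₀ h₁ h]
  one_mem' := ⟨IsHolo.const 1, fun _ _ _ _ _ => by simp⟩
  add_mem' := by
    rintro f g ⟨hf, hf'⟩ ⟨hg, hg'⟩
    refine ⟨hf.add hg, fun y₀ y₁ h₀ h₁ h => ?_⟩
    simp [hf' y₀ y₁ h₀ h₁ h, hg' y₀ y₁ h₀ h₁ h]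
  zero_mem' := ⟨IsHolo.const 0, fun _ _ _ _ _ => by simp⟩
  neg_mem' := by
    rintro f ⟨hf, hf'⟩
    refine ⟨hf.neg, fun y₀ y₁ h₀ h₁ h => ?_⟩
    simp [hf' y₀ y₁ h₀ h₁ h]

theorem IsHolo.restrict {V U : Opens P1} (h : V ≤ U) {s : Pts U → Gr} (hs : IsHolo s) :
    IsHolo (fun y : Pts V => s (y.incl h)) := by
  intro y
  obtain ⟨F, hF, eF⟩ := hs (y.incl h)
  refine ⟨F, hF, ?_⟩
  filter_upwards [eF] with z hz hV
  exact hz (h hV)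

/-- Restriction of superfunctions. -/
def OSec.restrict {V U : Opens P1} (h : V ≤ U) : OSec U →+* OSec V where
  toFun f := ⟨fun y => f.1 (y.incl h), f.2.1.restrict h, fun y₀ y₁ => f.2.2 (y₀.incl h) (y₁.incl h)⟩
  map_one' := rfl
  map_mul' _ _ := rfl
  map_zero' := rfl
  map_add' _ _ := rfl

/-- The coordinate maps are continuous. -/
theorem continuous_pt (i : Fin 2) : Continuous (fun z : ℂ => pt (i, z)) := by
  have hmk : @Continuous {v : Fin 2 → ℂ // v ≠ 0} P1 _ _ (Projectivization.mk' ℂ) :=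
    continuous_coinduced_rng
  fin_cases i
  · have : Continuous (fun z : ℂ => (⟨![1, z], fun e => one_ne_zero (congrFun e 0)⟩ :
        {v : Fin 2 → ℂ // v ≠ 0})) := by
      refine Continuous.subtype_mk (continuous_pi fun j => ?_) _
      fin_cases j <;> simp <;> fun_prop
    exact hmk.comp this
  · have : Continuous (fun z : ℂ => (⟨![z, 1], fun e => one_ne_zero (congrFun e 1)⟩ :
        {v : Fin 2 → ℂ // v ≠ 0})) := by
      refine Continuous.subtype_mk (continuous_pi fun j => ?_) _
      fin_cases j <;> simp <;> fun_prop
    exact hmk.comp this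

/-- Near a chart point over `V`, all chart points lie over `V`. -/
theorem eventually_mem {V : Opens P1} (y : Pts V) : ∀ᶠ z in 𝓝 y.1.2, pt (y.1.1, z) ∈ V :=
  (continuous_pt y.1.1).continuousAt.eventually_mem (V.2.mem_nhds y.2)

/-- Holomorphy is a local condition. -/
theorem IsHolo.of_cover {κ : Type*} {U : κ → Opens P1} {s : Pts (iSup U) → Gr}
    (hs : ∀ k, IsHolo (fun y : Pts (U k) => s (y.incl (le_iSup U k)))) : IsHolo s := by
  intro y
  obtain ⟨k, hk⟩ := Opens.mem_iSup.1 y.2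
  obtain ⟨F, hF, eF⟩ := hs k ⟨y.1, hk⟩
  refine ⟨F, hF, ?_⟩
  filter_upwards [eF, eventually_mem (V := U k) ⟨y.1, hk⟩] with z h1 h2 h3
  exact h1 h2

/-- Chart points with inverse coordinates are the same point. -/
theorem pt_eq {U : Opens P1} (y₀ y₁ : Pts U) (h₀ : y₀.1.1 = 0) (h₁ : y₁.1.1 = 1)
    (h : y₀.1.2 * y₁.1.2 = 1) : pt y₀.1 = pt y₁.1 := by
  obtain ⟨⟨i, z⟩, _⟩ := y₀
  obtain ⟨⟨j, w⟩, _⟩ := y₁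
  simp only at h₀ h₁ h
  subst h₀ h₁
  refine (Projectivization.mk_eq_mk_iff' ℂ _ _ _ _).2 ⟨z, ?_⟩
  funext j
  fin_cases j <;> simp [h]

/-- The presheaf of superfunctions. -/
def OPresheaf : TopCat.Presheaf RingCat.{0} P1 where
  obj U := RingCat.of (OSec U.unop)
  map f := RingCat.ofHom (OSec.restrict f.unop.le)

theorem OPresheaf_isSheaf : OPresheaf.IsSheaf := by
  rw [TopCat.Presheaf.isSheaf_iff_isSheafUniqueGluing]
  intro κ U sf hc
  have hcomp : ∀ (i j : κ) (y : ChartPt) (hi : pt y ∈ U i) (hj : pt y ∈ U j),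
      (sf i : OSec (U i)).1 ⟨y, hi⟩ = (sf j : OSec (U j)).1 ⟨y, hj⟩ := by
    intro i j y hi hj
    exact congrFun (congrArg Subtype.val (hc i j)) ⟨y, hi, hj⟩
  have hex : ∀ y : Pts (iSup U), ∃ k, pt y.1 ∈ U k := fun y => Opens.mem_iSup.1 y.2
  choose k hk using hex
  let g : Pts (iSup U) → Gr := fun y => (sf (k y) : OSec (U (k y))).1 ⟨y.1, hk y⟩
  have hg : ∀ (i : κ) (y : Pts (iSup U)) (hi : pt y.1 ∈ U i),
      g y = (sf i : OSec (U i)).1 ⟨y.1, hi⟩ := fun i y hi => hcomp _ _ _ _ _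
  refine ⟨(⟨g, ?_, ?_⟩ : OSec (iSup U)), ?_, ?_⟩
  · refine IsHolo.of_cover fun i => ?_
    have : (fun y : Pts (U i) => g (y.incl (le_iSup U i))) = (sf i : OSec (U i)).1 :=
      funext fun y => hg i _ y.2
    rw [this]
    exact (sf i : OSec (U i)).2.1
  · intro y₀ y₁ h₀ h₁ h
    have e := pt_eq y₀ y₁ h₀ h₁ h
    have h0 : pt y₀.1 ∈ U (k y₁) := by rw [e]; exact hk y₁
    rw [hg _ y₀ h0, hg _ y₁ (hk y₁)]
    exact (sf (k y₁) : OSec (U (k y₁))).2.2 ⟨y₀.1, h0⟩ ⟨y₁.1, hk y₁⟩ h₀ h₁ h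
  · intro i
    refine Subtype.ext (funext fun y => ?_)
    exact hg i _ y.2
  · intro t ht
    refine Subtype.ext (funext fun y => ?_)
    have := congrFun (congrArg Subtype.val (ht (k y))) ⟨y.1, hk y⟩
    exact this

/-- The structure sheaf of the projective superspace `ℙ^{1|2}`. -/
def O : Sheaf (Opens.grothendieckTopology P1) RingCat.{0} := ⟨OPresheaf, OPresheaf_isSheaf⟩

/-! ### Sheaves of modules from frames and transition functions -/

/-- A frame with index set `ι` over each of the two charts, with the parities of its members, and
the transition functions over the overlap: at the point with coordinate `w` in `U₁`, the member
`e_m` of the frame over `U₀` is `∑ₘ' (trans w m)(m') • e'_m'` in terms of the frame `e'` over `U₁`,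
with coefficients on the left. The index set may be infinite. -/
structure Frame (ι : Type) where
  /-- parity of the frame members -/
  parity : ι → ZMod 2
  /-- transition functions -/
  trans : ℂ → ι → (ι →₀ Gr)

namespace Frame

variable {ι : Type}

/-- The change of components: rewrite `∑ₘ cₘ e_m` over `U₀` as `∑ₘ scale(cₘ) ∑ₘ' gₘₘ' e'_m'`. -/
def transport (E : Frame ι) (w : ℂ) (c : ι →₀ Gr) : ι →₀ Gr :=
  Finsupp.linearCombination Gr (E.trans w) (c.mapRange (scale w) (map_zero _))

theorem transport_add (E : Frame ι) (w : ℂ) (c d : ι →₀ Gr) :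
    E.transport w (c + d) = E.transport w c + E.transport w d := by
  simp [transport, Finsupp.mapRange_add (map_add (scale w))]

theorem transport_smul (E : Frame ι) (w : ℂ) (a : Gr) (c : ι →₀ Gr) :
    E.transport w (a • c) = scale w a • E.transport w c := by
  have : (a • c).mapRange (scale w) (map_zero _) = scale w a • c.mapRange (scale w) (map_zero _) := by
    ext m
    simp
  rw [transport, this, map_smul, transport]

@[simp] theorem transport_zero (E : Frame ι) (w : ℂ) : E.transport w 0 = 0 := by
  simp [transport]

/-- Local finiteness of a family of finite combinations of frame members: near every chart point
only finitely many members of the frame occur. -/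
def LocFin {U : Opens P1} (s : Pts U → ι →₀ Gr) : Prop :=
  ∀ y : Pts U, ∃ T : Finset ι, ∀ᶠ z in 𝓝 y.1.2, ∀ h : pt (y.1.1, z) ∈ U,
    (s ⟨(y.1.1, z), h⟩).support ⊆ T

theorem LocFin.add {U : Opens P1} {s t : Pts U → ι →₀ Gr} (hs : LocFin s) (ht : LocFin t) :
    LocFin (s + t) := by
  classical
  intro y
  obtain ⟨S, hS⟩ := hs y
  obtain ⟨T, hT⟩ := ht y
  refine ⟨S ∪ T, ?_⟩
  filter_upwards [hS, hT] with z h1 h2 h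
  exact Finsupp.support_add.trans (Finset.union_subset_union (h1 h) (h2 h))

theorem LocFin.smul {U : Opens P1} (f : OSec U) {s : Pts U → ι →₀ Gr} (hs : LocFin s) :
    LocFin (f • s) := by
  intro y
  obtain ⟨S, hS⟩ := hs y
  refine ⟨S, ?_⟩
  filter_upwards [hS] with z h1 h
  exact (Finsupp.support_smul (b := f.1 ⟨(y.1.1, z), h⟩)).trans (h1 h)

theorem LocFin.restrict {V U : Opens P1} (h : V ≤ U) {s : Pts U → ι →₀ Gr} (hs : LocFin s) :
    LocFin (fun y : Pts V => s (y.incl h)) := by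
  intro y
  obtain ⟨S, hS⟩ := hs (y.incl h)
  refine ⟨S, ?_⟩
  filter_upwards [hS] with z hz hV
  exact hz (h hV)

/-- Local finiteness is a local condition. -/
theorem LocFin.of_cover {κ : Type*} {U : κ → Opens P1} {s : Pts (iSup U) → ι →₀ Gr}
    (hs : ∀ k, LocFin (fun y : Pts (U k) => s (y.incl (le_iSup U k)))) : LocFin s := by
  intro y
  obtain ⟨k, hk⟩ := Opens.mem_iSup.1 y.2
  obtain ⟨T, hT⟩ := hs k ⟨y.1, hk⟩
  refine ⟨T, ?_⟩
  filter_upwards [hT, eventually_mem (V := U k) ⟨y.1, hk⟩] with z h1 h2 h3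
  exact h1 h2

/-- The sections over `U` of the sheaf defined by a frame: locally finite holomorphic combinations
of the frame in each chart, that match over the overlap. Superfunctions act on the left. -/
def Sec (E : Frame ι) (U : Opens P1) : Submodule (OSec U) (Pts U → ι →₀ Gr) where
  carrier := {s | (∀ m, IsHolo fun y => s y m) ∧ LocFin s ∧
    ∀ y₀ y₁ : Pts U, y₀.1.1 = 0 → y₁.1.1 = 1 → y₀.1.2 * y₁.1.2 = 1 →
      s y₁ = E.transport y₁.1.2 (s y₀)}
  add_mem' := by
    rintro s t ⟨hs, hs', hs''⟩ ⟨ht, ht', ht''⟩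
    refine ⟨fun m => (hs m).add (ht m), hs'.add ht', fun y₀ y₁ h₀ h₁ h => ?_⟩
    rw [Pi.add_apply, Pi.add_apply, transport_add, hs'' y₀ y₁ h₀ h₁ h, ht'' y₀ y₁ h₀ h₁ h]
  zero_mem' := ⟨fun _ => IsHolo.const 0, fun _ => ⟨∅, Filter.Eventually.of_forall fun _ _ => by simp⟩,
    fun _ _ _ _ _ => by simp⟩
  smul_mem' := by
    rintro f s ⟨hs, hs', hs''⟩
    refine ⟨fun m => f.2.1.mul (hs m), hs'.smul f, fun y₀ y₁ h₀ h₁ h => ?_⟩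
    have e : ∀ y, (f • s) y = f.1 y • s y := fun _ => rfl
    rw [e, e, transport_smul, hs'' y₀ y₁ h₀ h₁ h, f.2.2 y₀ y₁ h₀ h₁ h]

/-- Restriction of sections. -/
def Sec.restrict (E : Frame ι) {V U : Opens P1} (h : V ≤ U) :
    E.Sec U →ₛₗ[OSec.restrict h] E.Sec V where
  toFun s := ⟨fun y => s.1 (y.incl h), fun m => (s.2.1 m).restrict h, s.2.2.1.restrict h,
    fun y₀ y₁ => s.2.2.2 (y₀.incl h) (y₁.incl h)⟩
  map_add' _ _ := rfl
  map_smul' _ _ := rfl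

/-- The presheaf of abelian groups of sections. -/
def secPresheaf (E : Frame ι) : TopCat.Presheaf AddCommGrpCat.{0} P1 where
  obj U := AddCommGrpCat.of (E.Sec U.unop)
  map f := AddCommGrpCat.ofHom (Sec.restrict E f.unop.le).toAddMonoidHom

instance (E : Frame ι) (U : (Opens P1)ᵒᵖ) : Module (O.obj.obj U) (E.secPresheaf.obj U) :=
  inferInstanceAs (Module (OSec U.unop) (E.Sec U.unop))

/-- The presheaf of modules defined by a frame. -/
def presheaf (E : Frame ι) : PresheafOfModules.{0} O.obj :=
  PresheafOfModules.ofPresheaf E.secPresheaf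
    (fun _ _ f r m => (Sec.restrict E f.unop.le).map_smulₛₗ r m)

theorem secPresheaf_isSheaf (E : Frame ι) : E.secPresheaf.IsSheaf := by
  rw [TopCat.Presheaf.isSheaf_iff_isSheafUniqueGluing]
  intro κ U sf hc
  have hcomp : ∀ (i j : κ) (y : ChartPt) (hi : pt y ∈ U i) (hj : pt y ∈ U j),
      (sf i : E.Sec (U i)).1 ⟨y, hi⟩ = (sf j : E.Sec (U j)).1 ⟨y, hj⟩ := by
    intro i j y hi hj
    exact congrFun (congrArg Subtype.val (hc i j)) ⟨y, hi, hj⟩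
  have hex : ∀ y : Pts (iSup U), ∃ k, pt y.1 ∈ U k := fun y => Opens.mem_iSup.1 y.2
  choose k hk using hex
  let g : Pts (iSup U) → ι →₀ Gr := fun y => (sf (k y) : E.Sec (U (k y))).1 ⟨y.1, hk y⟩
  have hg : ∀ (i : κ) (y : Pts (iSup U)) (hi : pt y.1 ∈ U i),
      g y = (sf i : E.Sec (U i)).1 ⟨y.1, hi⟩ := fun i y hi => hcomp _ _ _ _ _
  have hg' : ∀ i : κ, (fun y : Pts (U i) => g (y.incl (le_iSup U i))) = (sf i : E.Sec (U i)).1 :=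
    fun i => funext fun y => hg i _ y.2
  refine ⟨(⟨g, ?_, ?_, ?_⟩ : E.Sec (iSup U)), ?_, ?_⟩
  · refine fun m => IsHolo.of_cover fun i => ?_
    have : (fun y : Pts (U i) => g (y.incl (le_iSup U i)) m) =
        fun y => (sf i : E.Sec (U i)).1 y m := by rw [← hg' i]
    rw [this]
    exact (sf i : E.Sec (U i)).2.1 m
  · refine LocFin.of_cover fun i => ?_
    rw [hg' i]
    exact (sf i : E.Sec (U i)).2.2.1
  · intro y₀ y₁ h₀ h₁ h
    have e := pt_eq y₀ y₁ h₀ h₁ h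
    have h0 : pt y₀.1 ∈ U (k y₁) := by rw [e]; exact hk y₁
    rw [hg _ y₀ h0, hg _ y₁ (hk y₁)]
    exact (sf (k y₁) : E.Sec (U (k y₁))).2.2.2 ⟨y₀.1, h0⟩ ⟨y₁.1, hk y₁⟩ h₀ h₁ h
  · intro i
    refine Subtype.ext (funext fun y => ?_)
    exact hg i _ y.2
  · intro t ht
    refine Subtype.ext (funext fun y => ?_)
    have := congrFun (congrArg Subtype.val (ht (k y))) ⟨y.1, hk y⟩
    exact this

/-- The sheaf of modules on `ℙ^{1|2}` defined by a frame: locally on each chart it is the direct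
sum of copies of the structure sheaf, one for each member of the frame. -/
def sheaf (E : Frame ι) : SheafOfModules.{0} O := ⟨E.presheaf, E.secPresheaf_isSheaf⟩

/-- The action of a morphism on sections. -/
def onSec {κ : Type} {E : Frame ι} {F : Frame κ} (f : E.sheaf ⟶ F.sheaf) (U : Opens P1) :
    E.Sec U → F.Sec U := fun s => (f.val.app (op U)).hom s

/-- A section is homogeneous of parity `q`: in each chart, the coefficient of a frame member of
parity `p` has parity `q - p`. -/
def IsHomog {E : Frame ι} {U : Opens P1} (q : ZMod 2) (s : E.Sec U) : Prop :=
  ∀ (y : Pts U) (m : ι), s.1 y m ∈ grPart (q - E.parity m)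

/-- A morphism is even (`d = 0`) or odd (`d = 1`): it shifts the parity of sections by `d`. -/
def HasParity {κ : Type} {E : Frame ι} {F : Frame κ} (d : ZMod 2) (f : E.sheaf ⟶ F.sheaf) : Prop :=
  ∀ (U : Opens P1) (q : ZMod 2) (s : E.Sec U), IsHomog q s → IsHomog (q + d) (onSec f U s)

/-- The sheaf is locally free of rank `p|q`: every point has an open neighbourhood `U` with `p` even
and `q` odd sections over `U` that form a basis over every open subset of `U`. -/
def IsLocallyFreeOfRank (E : Frame ι) (p q : ℕ) : Prop :=
  ∀ x : P1, ∃ (U : Opens P1) (_ : x ∈ U) (e : Fin p ⊕ Fin q → E.Sec U),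
    (∀ i, IsHomog 0 (e (Sum.inl i))) ∧ (∀ j, IsHomog 1 (e (Sum.inr j))) ∧
    ∀ (V : Opens P1) (h : V ≤ U),
      LinearIndependent (OSec V) (fun k => Sec.restrict E h (e k)) ∧
      Submodule.span (OSec V) (Set.range fun k => Sec.restrict E h (e k)) = ⊤

/-- The sheaf is of finite type at `x`: over some open neighbourhood `U` of `x` finitely many
sections generate it, in the sense that every section over an open subset of `U` is locally a
combination of them. -/
def IsFiniteTypeAt (E : Frame ι) (x : P1) : Prop :=
  ∃ (U : Opens P1) (_ : x ∈ U) (n : ℕ) (t : Fin n → E.Sec U),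
    ∀ (V : Opens P1) (hV : V ≤ U) (s : E.Sec V), ∀ y ∈ V, ∃ (W : Opens P1) (_ : y ∈ W) (hW : W ≤ V),
      Sec.restrict E hW s ∈
        Submodule.span (OSec W) (Set.range fun i => Sec.restrict E (hW.trans hV) (t i))

/-- The linear extension of a map on frames with constant coefficients. -/
def extend {κ : Type} (φ : ι → κ →₀ ℂ) : (ι →₀ Gr) →ₗ[Gr] (κ →₀ Gr) :=
  Finsupp.linearCombination Gr fun m => (φ m).mapRange cst (map_zero _)

/-- The map on frames commutes with the transition functions. -/
def Commutes {κ : Type} (E : Frame ι) (F : Frame κ) (φ : ι → κ →₀ ℂ) : Prop :=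
  ∀ (w : ℂ), w ≠ 0 → ∀ m, extend φ (E.trans w m) = F.transport w (extend φ (Finsupp.single m 1))

theorem extend_apply {κ : Type} (φ : ι → κ →₀ ℂ) (c : ι →₀ Gr) (T : Finset ι) (hT : c.support ⊆ T)
    (k : κ) : extend φ c k = ∑ m ∈ T, c m * cst (φ m k) := by
  rw [extend, Finsupp.linearCombination_apply, Finsupp.sum_of_support_subset _ hT _ (by simp),
    Finsupp.finsetSum_apply]
  refine Finset.sum_congr rfl fun m _ => ?_
  simp

theorem transport_extend {κ : Type} {E : Frame ι} {F : Frame κ} {φ : ι → κ →₀ ℂ}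
    (hφ : Commutes E F φ) (w : ℂ) (hw : w ≠ 0) (c : ι →₀ Gr) :
    extend φ (E.transport w c) = F.transport w (extend φ c) := by
  induction c using Finsupp.induction_linear with
  | zero => simp
  | add c d hc hd => simp only [transport_add, map_add, hc, hd]
  | single m a =>
    have h : Finsupp.single m a = a • Finsupp.single m (1 : Gr) := by simp
    have h1 : E.transport w (Finsupp.single m 1) = E.trans w m := by simp [transport]
    rw [h, transport_smul, map_smul, map_smul, transport_smul, h1, hφ w hw m]

/-- The map on sections given, in both charts, by a map on frames with constant coefficients. -/
def secMap {κ : Type} {E : Frame ι} {F : Frame κ} (φ : ι → κ →₀ ℂ) (hφ : Commutes E F φ)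
    {U : Opens P1} (s : E.Sec U) : F.Sec U :=
  ⟨fun y => extend φ (s.1 y), by
    classical
    refine ⟨fun k y => ?_, fun y => ?_, fun y₀ y₁ h₀ h₁ h => ?_⟩
    · obtain ⟨T, hT⟩ := s.2.2.1 y
      obtain ⟨F, hF, eF⟩ := IsHolo.sum T (s := fun m y => s.1 y m * cst (φ m k))
        (fun m _ => (s.2.1 m).mul (IsHolo.const _)) y
      refine ⟨F, hF, ?_⟩
      filter_upwards [hT, eF] with z h1 h2 h
      rw [extend_apply φ _ T (h1 h) k, ← h2 h]
    · obtain ⟨T, hT⟩ := s.2.2.1 y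
      refine ⟨T.biUnion fun m => (φ m).support, ?_⟩
      filter_upwards [hT] with z h1 h k hk
      by_contra hc
      refine Finsupp.mem_support_iff.1 hk ?_
      rw [extend_apply φ _ T (h1 h) k]
      refine Finset.sum_eq_zero fun m hm => ?_
      have : φ m k = 0 := by
        by_contra h0
        exact hc (Finset.mem_biUnion.2 ⟨m, hm, Finsupp.mem_support_iff.2 h0⟩)
      simp [this]
    · have hw : y₁.1.2 ≠ 0 := right_ne_zero_of_mul_eq_one h
      change extend φ (s.1 y₁) = F.transport _ (extend φ (s.1 y₀))
      rw [s.2.2.2 y₀ y₁ h₀ h₁ h, transport_extend hφ _ hw]⟩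

/-- The morphism of sheaves given, in both charts, by a map on frames with constant coefficients
that commutes with the transition functions. It is linear over superfunctions acting on the left. -/
def ofFrames {κ : Type} (E : Frame ι) (F : Frame κ) (φ : ι → κ →₀ ℂ) (hφ : Commutes E F φ) :
    E.sheaf ⟶ F.sheaf where
  val := PresheafOfModules.homMk (M₁ := E.presheaf) (M₂ := F.presheaf)
    { app := fun U => AddCommGrpCat.ofHom (X := E.Sec U.unop) (Y := F.Sec U.unop)
        { toFun := secMap φ hφ
          map_zero' := Subtype.ext (funext fun _ => map_zero (extend φ))
          map_add' := fun s t => Subtype.ext (funext fun y => map_add (extend φ) (s.1 y) (t.1 y)) }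
      naturality := fun _ _ _ => rfl }
    (fun U r m => Subtype.ext (funext fun y =>
      map_smul (extend φ) ((r : OSec U.unop).1 y) ((m : E.Sec U.unop).1 y)))

/-- The subframe of the members that satisfy `P` (used for `P` stable under the transition
functions, so that no component is dropped). -/
def sub (E : Frame ι) (P : ι → Prop) : Frame {m // P m} where
  parity m := E.parity m.1
  trans w m := (E.trans w m.1).subtypeDomain P

/-- A map on frames, restricted to subframes. -/
def subMap (φ : ι → ι →₀ ℂ) (P Q : ι → Prop) : {m // P m} → {m // Q m} →₀ ℂ :=
  fun m => (φ m.1).subtypeDomain Q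

theorem linearCombination_sub (V : ι → ι →₀ Gr) (P Q : ι → Prop) (c : ι →₀ Gr)
    (hc : ∀ m, c m ≠ 0 → P m) :
    Finsupp.linearCombination Gr (fun m : {m // P m} => (V m.1).subtypeDomain Q)
      (c.subtypeDomain P) = (Finsupp.linearCombination Gr V c).subtypeDomain Q := by
  classical
  have key : ∀ d : {m // P m} →₀ Gr,
      Finsupp.linearCombination Gr (fun m : {m // P m} => (V m.1).subtypeDomain Q) d =
      (Finsupp.linearCombination Gr V (d.embDomain (Function.Embedding.subtype P))).subtypeDomain
        Q := by
    intro d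
    induction d using Finsupp.induction_linear with
    | zero => simp
    | add d e hd he => rw [map_add, hd, he, Finsupp.embDomain_add, map_add,
        Finsupp.subtypeDomain_add]
    | single m a =>
      rw [Finsupp.embDomain_single, Finsupp.linearCombination_single,
        Finsupp.linearCombination_single]
      ext
      rfl
  rw [key]
  congr 2
  ext m
  by_cases hm : P m
  · exact Finsupp.embDomain_apply_self (Function.Embedding.subtype P) (c.subtypeDomain P) ⟨m, hm⟩
  · have h0 : c m = 0 := by
      by_contra h
      exact hm (hc m h)
    rw [h0]
    refine Finsupp.embDomain_of_notMem_range _ _ _ ?_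
    rintro ⟨x, rfl⟩
    exact hm x.2

theorem Commutes.sub {E : Frame ι} {φ : ι → ι →₀ ℂ} (h : Commutes E E φ) (P Q : ι → Prop)
    (hE : ∀ w m, P m → ∀ m', E.trans w m m' ≠ 0 → P m')
    (hφ : ∀ m, P m → ∀ m', φ m m' ≠ 0 → Q m') :
    Commutes (E.sub P) (E.sub Q) (subMap φ P Q) := by
  intro w hw m
  have h1 := linearCombination_sub (fun m => (φ m).mapRange cst (map_zero _)) P Q
    (E.trans w m.1) (hE w m.1 m.2)
  have h2 := linearCombination_sub (E.trans w) Q Q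
    (((φ m.1).mapRange cst (map_zero _)).mapRange (scale w) (map_zero _)) (fun m' h' => by
      refine hφ m.1 m.2 m' fun h0 => h' ?_
      simp [h0])
  have h3 := h w hw m.1
  have e1 : extend (subMap φ P Q) (Finsupp.single m 1) =
      ((φ m.1).subtypeDomain Q).mapRange cst (map_zero _) := by
    simp [extend, subMap]
  have e2 : extend φ (Finsupp.single m.1 1) = (φ m.1).mapRange cst (map_zero _) := by
    simp [extend]
  rw [e2] at h3
  rw [e1]
  have e3 : (fun m : {m // P m} => ((φ m.1).mapRange cst (map_zero _)).subtypeDomain Q) =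
      fun m => (subMap φ P Q m).mapRange cst (map_zero _) := by
    funext m
    ext m'
    rfl
  have e4 : (((φ m.1).mapRange cst (map_zero _)).mapRange (scale w) (map_zero _)).subtypeDomain Q =
      (((φ m.1).subtypeDomain Q).mapRange cst (map_zero _)).mapRange (scale w) (map_zero _) := by
    ext m'
    rfl
  rw [e3] at h1
  rw [e4] at h2
  refine h1.trans (Eq.trans ?_ h2.symm)
  exact congrArg (Finsupp.subtypeDomain Q) h3

/-- The parity shift `Π`: the same transition functions with all parities reversed. -/
def pi (E : Frame ι) : Frame ι where
  parity m := E.parity m + 1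
  trans := E.trans

/-! ### Supersymmetric powers of a frame -/

section Sym

variable [Fintype ι] [LinearOrder ι]

/-- The parity of the monomial `∏ᵢ eᵢ ^ αᵢ`. -/
def monoParity (E : Frame ι) (α : ι → ℕ) : ZMod 2 := ∑ i, (α i : ZMod 2) * E.parity i

open Classical in
/-- The coefficient in `e^α * e^β = ± e^(α + β)` for ordered supercommutative monomials: zero if an
odd `eᵢ` would be repeated, and otherwise the sign of reordering the odd factors. -/
def monoSign (E : Frame ι) (α β : ι → ℕ) : ℤ :=
  if ∃ i, E.parity i = 1 ∧ 2 ≤ α i + β i then 0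
  else (-1) ^ (∑ i, ∑ j, if j < i ∧ E.parity i = 1 ∧ E.parity j = 1 then α i * β j else 0)

/-- The product in the supersymmetric algebra of the free module on a frame, for polynomials with
coefficients on the left: `(a e^α)(b e^β) = (-1)^(|b||e^α|) ab e^α e^β`. -/
def superMul (E : Frame ι) (x y : (ι → ℕ) →₀ Gr) : (ι → ℕ) →₀ Gr :=
  x.sum fun α a => y.sum fun β b =>
    Finsupp.single (α + β)
      (E.monoSign α β • (a * if E.monoParity α = 1 then grInvol b else b))

/-- Powers in the supersymmetric algebra. -/
def superPow (E : Frame ι) (x : (ι → ℕ) →₀ Gr) : ℕ → ((ι → ℕ) →₀ Gr)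
  | 0 => Finsupp.single 0 1
  | n + 1 => E.superMul x (superPow E x n)

/-- The transition function on monomials: `∏ᵢ eᵢ ^ αᵢ ↦ ∏ᵢ (∑ⱼ gᵢⱼ e'ⱼ) ^ αᵢ`. -/
def monoTrans (E : Frame ι) (w : ℂ) (α : ι → ℕ) : (ι → ℕ) →₀ Gr :=
  ((Finset.univ : Finset ι).sort (· ≤ ·)).foldr
    (fun i acc => E.superMul
      (E.superPow ((E.trans w i).mapDomain fun j => Pi.single j 1) (α i)) acc)
    (Finsupp.single 0 1)

/-- The `n`-th supersymmetric power `Symⁿ`, with frame the monomials of degree `n` in which the odd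
members occur at most once. -/
def symPower (E : Frame ι) (n : ℕ) :
    Frame {α : ι → ℕ // ∑ i, α i = n ∧ ∀ i, E.parity i = 1 → α i ≤ 1} where
  parity α := E.monoParity α.1
  trans w α := (E.monoTrans w α.1).subtypeDomain _

end Sym

end Frame

/-- The tangent sheaf `𝒯` of `ℙ^{1|2}`, with frame `∂_z, ∂_θ₁, ∂_θ₂` (indices `0, 1, 2`) in each
chart, and the chain rule
`∂_z⁽⁰⁾ = -w² ∂_w - w ∑ᵢ θᵢ ∂_θᵢ` and `∂_θᵢ⁽⁰⁾ = w ∂_θᵢ`. -/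
def tangent : Frame (Fin 3) where
  parity j := if j = 0 then 0 else 1
  trans w j :=
    if j = 0 then
      Finsupp.single 0 (cst (-w ^ 2)) - ∑ i : Fin 2, Finsupp.single i.succ (cst w * theta i)
    else Finsupp.single j (cst w)

/-- The sheaf `Π Symⁿ Π𝒯`. -/
def piSymPiT (n : ℕ) := (tangent.pi.symPower n).pi

/-! ### Superforms, pseudoforms and integral forms -/

/-- The symbols in one variable `dθ`: the powers `dθᵃ` with `a ∈ ℤ`, and the derivatives
`δ⁽ˡ⁾(dθ)` of the delta function. -/
inductive Symb : Type
  | pow (a : ℤ) : Symb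
  | delta (l : ℕ) : Symb

namespace Symb

/-- Form degree: `a` for `dθᵃ` and `-l` for `δ⁽ˡ⁾(dθ)`. -/
def degree : Symb → ℤ
  | pow a => a
  | delta l => -l

/-- Picture number: `0` for powers and `1` for deltas. -/
def picture : Symb → ℤ
  | pow _ => 0
  | delta _ => 1

/-- Deltas are odd, powers of `dθ` are even. -/
def parity : Symb → ZMod 2
  | pow _ => 0
  | delta _ => 1

/-- Homogeneity: `u(dθ / w) = w ^ weight(u) * u(dθ)`. -/
def weight : Symb → ℤ
  | pow a => -a
  | delta l => l + 1

/-- The derivative of a symbol, as a coefficient and a symbol: `(dθᵃ)' = a dθᵃ⁻¹` and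
`(δ⁽ˡ⁾)' = δ⁽ˡ⁺¹⁾`. -/
def deriv : Symb → ℂ × Symb
  | pow a => (a, pow (a - 1))
  | delta l => (1, delta (l + 1))

/-- The Heaviside operator `Θ(ι_θ)`: `δ⁽ˡ⁾(dθ) ↦ (-1)ˡ l! / dθˡ⁺¹`, and `0` on powers of `dθ`. -/
def heaviside : Symb → ℂ × Symb
  | pow a => (0, pow a)
  | delta l => ((-1) ^ l * l.factorial, pow (-(l : ℤ) - 1))

/-- The operator `η`: `1 / dθˡ⁺¹ ↦ ((-1)ˡ / l!) δ⁽ˡ⁾(dθ)` for `l ≥ 0`, and `0` on non-negative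
powers of `dθ` and on deltas. -/
def eta : Symb → ℂ × Symb
  | pow (Int.ofNat a) => (0, pow a)
  | pow (Int.negSucc l) => ((-1) ^ l / l.factorial, delta l)
  | delta l => (0, delta l)

end Symb

/-- Monomials `dz^ε u₁ u₂`, with `ε ∈ {0, 1}` and `uᵢ` a symbol in `dθᵢ`. -/
abbrev FormMono : Type := Bool × (Fin 2 → Symb)

namespace FormMono

/-- Form degree. -/
def degree (m : FormMono) : ℤ := (if m.1 then 1 else 0) + ∑ i, (m.2 i).degree

/-- Picture number. -/
def picture (m : FormMono) : ℤ := ∑ i, (m.2 i).picture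

/-- The total homogeneity weight of the symbols. -/
def weight (m : FormMono) : ℤ := ∑ i, (m.2 i).weight

/-- Apply an operator on symbols to the `i`-th symbol. -/
def slot (i : Fin 2) (τ : Symb → ℂ × Symb) (m : FormMono) : FormMono →₀ ℂ :=
  Finsupp.single (m.1, Function.update m.2 i (τ (m.2 i)).2) (τ (m.2 i)).1

end FormMono

/-- All forms on `ℙ^{1|2}`. The transition functions are
`dz⁽⁰⁾ = -w⁻² dw` and `dθᵢ⁽⁰⁾ = w⁻¹ (dθᵢ - w⁻¹ θᵢ dw)`, extended to symbols by homogeneity and by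
Taylor expansion, `u(dθᵢ - w⁻¹ θᵢ dw) = u(dθᵢ) - w⁻¹ θᵢ dw u'(dθᵢ)`, which stops since `dw² = 0`. -/
def allForms : Frame FormMono where
  parity m := (if m.1 then 1 else 0) + ∑ i, (m.2 i).parity
  trans w m :=
    if m.1 then Finsupp.single m (cst (-w ^ (m.weight - 2)))
    else Finsupp.single m (cst (w ^ m.weight)) - ∑ i, Finsupp.single
      (true, Function.update m.2 i (m.2 i).deriv.2)
      (cst ((m.2 i).deriv.1 * w ^ (m.weight - 1)) * theta i)

/-- The forms `Ω^{k;p}` of degree `k` and picture number `p`: the extended superforms for `p = 0`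
(with arbitrary integer powers of `dθ₁` and `dθ₂`), the pseudoforms for `p = 1`, and the integral
forms for `p = 2`. -/
def forms (k p : ℤ) : Frame {m : FormMono // m.degree = k ∧ m.picture = p} :=
  allForms.sub fun m => m.degree = k ∧ m.picture = p

theorem allForms_trans_bidegree (w : ℂ) (m m' : FormMono) (h : allForms.trans w m m' ≠ 0) :
    m'.degree = m.degree ∧ m'.picture = m.picture := by
  classical
  obtain ⟨ε, u⟩ := m
  have hdeg : ∀ v : Symb, v.deriv.1 ≠ 0 → v.deriv.2.degree = v.degree - 1 := by
    rintro (a | l) _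
    · rfl
    · simp [Symb.deriv, Symb.degree]; ring
  have hpic : ∀ v : Symb, v.deriv.2.picture = v.picture := by
    rintro (a | l) <;> rfl
  cases ε
  · by_cases h1 : m' = (false, u)
    · subst h1; exact ⟨rfl, rfl⟩
    · have h2 : ∃ i, m' = (true, Function.update u i (u i).deriv.2) ∧ (u i).deriv.1 ≠ 0 := by
        by_contra hc
        push Not at hc
        refine h ?_
        simp only [allForms, Bool.false_eq_true, if_false, Finsupp.sub_apply, Finsupp.finsetSum_apply]
        rw [Finsupp.single_eq_of_ne h1, zero_sub, neg_eq_zero]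
        refine Finset.sum_eq_zero fun i _ => ?_
        by_cases h3 : m' = (true, Function.update u i (u i).deriv.2)
        · rw [h3, hc i h3]; simp
        · exact Finsupp.single_eq_of_ne h3
      obtain ⟨i, rfl, hi⟩ := h2
      have e1 := hdeg _ hi
      have e2 := hpic (u i)
      fin_cases i <;>
        simp_all [FormMono.degree, FormMono.picture, Fin.sum_univ_two, Function.update] <;> ring
  · have : m' = (true, u) := by
      by_contra h1
      exact h (by simp [allForms, Finsupp.single_eq_of_ne h1])
    subst this; exact ⟨rfl, rfl⟩

theorem slot_weight (i : Fin 2) (τ : Symb → ℂ × Symb) (u : Fin 2 → Symb) (ε ε' : Bool)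
    (h : (τ (u i)).2.weight = (u i).weight) :
    FormMono.weight (ε, Function.update u i (τ (u i)).2) = FormMono.weight (ε', u) := by
  fin_cases i <;> simp_all [FormMono.weight, Fin.sum_univ_two, Function.update]

/-- An operator on symbols that preserves the weights and commutes with the derivative acts on all
forms. -/
theorem slot_commutes (i : Fin 2) (τ : Symb → ℂ × Symb)
    (hW : ∀ u, (τ u).1 ≠ 0 → (τ u).2.weight = u.weight)
    (hD : ∀ u, Finsupp.single (τ u.deriv.2).2 (u.deriv.1 * (τ u.deriv.2).1) =
      Finsupp.single (τ u).2.deriv.2 ((τ u).1 * (τ u).2.deriv.1)) :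
    Frame.Commutes allForms allForms (FormMono.slot i τ) := by
  classical
  rintro w hw ⟨ε, u⟩
  have hex : ∀ (ε : Bool) (v : Fin 2 → Symb) (a : Gr),
      Frame.extend (FormMono.slot i τ) (Finsupp.single (ε, v) a) =
      Finsupp.single (ε, Function.update v i (τ (v i)).2) (a * cst (τ (v i)).1) := by
    intro ε v a
    simp [Frame.extend, FormMono.slot]
  have htr : ∀ (n : FormMono) (c : ℂ), allForms.transport w (Finsupp.single n (cst c)) =
      cst c • allForms.trans w n := by
    intro n c
    simp [Frame.transport]
  rw [hex, one_mul, htr]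
  by_cases hc : (τ (u i)).1 = 0
  · rw [hc, map_zero, zero_smul]
    cases ε
    · simp only [allForms, Bool.false_eq_true, if_false, map_sub, map_sum, hex, hc, map_zero,
        mul_zero, Finsupp.single_zero, zero_sub, neg_eq_zero]
      refine Finset.sum_eq_zero fun j _ => ?_
      by_cases hj : j = i
      · subst hj
        have := hD (u j)
        rw [hc, zero_mul, Finsupp.single_zero, Finsupp.single_eq_zero] at this
        rw [Function.update_self, mul_assoc, ← Algebra.commutes, ← mul_assoc, ← map_mul,
          mul_right_comm, this]
        simp
      · rw [Function.update_of_ne (Ne.symm hj), hc]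
        simp
    · simp only [allForms, if_true, hex, hc, map_zero, mul_zero, Finsupp.single_zero]
  · have hwt := fun ε ε' => slot_weight i τ u ε ε' (hW _ hc)
    cases ε
    · simp only [allForms, Bool.false_eq_true, if_false, map_sub, map_sum, hex, smul_sub,
        Finset.smul_sum, Finsupp.smul_single, smul_eq_mul, hwt false false]
      congr 1
      · rw [Algebra.commutes]
      · refine Finset.sum_congr rfl fun j _ => ?_
        by_cases hj : j = i
        · subst hj
          have := hD (u j)
          simp only [Function.update_self, Function.update_idem]
          rw [mul_assoc, ← Algebra.commutes, ← mul_assoc, ← mul_assoc, ← map_mul, ← map_mul]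
          have h2 := congrArg (fun f : Symb →₀ ℂ => Finsupp.mapRange
            (fun c => cst (c * w ^ (FormMono.weight (false, u) - 1)) * theta j) (by simp) f) this
          simp only [Finsupp.mapRange_single] at h2
          have h3 := congrArg (Finsupp.mapDomain
            (fun s => ((true, Function.update u j s) : FormMono))) h2
          simp only [Finsupp.mapDomain_single] at h3
          rw [mul_right_comm, ← mul_assoc]
          exact h3
        · rw [Function.update_of_ne (Ne.symm hj), Function.update_of_ne hj,
            Function.update_comm hj, mul_assoc _ (theta j), ← Algebra.commutes, ← mul_assoc,
            ← mul_assoc, ← map_mul, ← map_mul, mul_comm (_ * _) (τ (u i)).1]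
    · simp only [allForms, if_true, hex, Finsupp.smul_single, smul_eq_mul, hwt true true]
      rw [Algebra.commutes]

theorem heaviside_weight (u : Symb) (h : u.heaviside.1 ≠ 0) : u.heaviside.2.weight = u.weight := by
  cases u with
  | pow a => exact absurd rfl h
  | delta l => simp [Symb.heaviside, Symb.weight]; ring

theorem heaviside_deriv (u : Symb) :
    Finsupp.single u.deriv.2.heaviside.2 (u.deriv.1 * u.deriv.2.heaviside.1) =
      Finsupp.single u.heaviside.2.deriv.2 (u.heaviside.1 * u.heaviside.2.deriv.1) := by
  cases u with
  | pow a => simp [Symb.heaviside, Symb.deriv]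
  | delta l =>
    have e : -((l + 1 : ℕ) : ℤ) - 1 = -(l : ℤ) - 1 - 1 := by push_cast; ring
    simp only [Symb.heaviside, Symb.deriv, e]
    congr 1
    rw [Nat.factorial_succ]
    push_cast
    ring

theorem eta_weight (u : Symb) (h : u.eta.1 ≠ 0) : u.eta.2.weight = u.weight := by
  rcases u with (a | l) | l
  · exact absurd rfl h
  · simp [Symb.eta, Symb.weight, Int.negSucc_eq]
  · exact absurd rfl h

theorem eta_deriv (u : Symb) :
    Finsupp.single u.deriv.2.eta.2 (u.deriv.1 * u.deriv.2.eta.1) =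
      Finsupp.single u.eta.2.deriv.2 (u.eta.1 * u.eta.2.deriv.1) := by
  rcases u with ((_ | a) | l) | l
  · simp [Symb.eta, Symb.deriv]
  · simp [Symb.eta, Symb.deriv]
  · have : Int.negSucc l - 1 = Int.negSucc (l + 1) := by simp [Int.negSucc_eq]; ring
    simp only [Symb.eta, Symb.deriv, this]
    congr 1
    have : (l.factorial : ℂ) ≠ 0 := by exact_mod_cast l.factorial_ne_zero
    have : (l + 1 : ℂ) ≠ 0 := by exact_mod_cast l.succ_ne_zero
    rw [Nat.factorial_succ, Int.cast_negSucc]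
    push_cast
    field_simp
    ring
  · simp [Symb.eta, Symb.deriv]

/-- An operator on symbols that shifts degree and picture number by `d` does so on all forms. -/
theorem slot_bidegree (i : Fin 2) (τ : Symb → ℂ × Symb) (d : ℤ)
    (h : ∀ u, (τ u).1 ≠ 0 → (τ u).2.degree = u.degree + d ∧ (τ u).2.picture = u.picture + d)
    (m m' : FormMono) (hm : FormMono.slot i τ m m' ≠ 0) :
    m'.degree = m.degree + d ∧ m'.picture = m.picture + d := by
  classical
  obtain ⟨ε, u⟩ := m
  have h1 : m' = (ε, Function.update u i (τ (u i)).2) := by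
    by_contra hc
    exact hm (Finsupp.single_eq_of_ne hc)
  have h2 : (τ (u i)).1 ≠ 0 := by
    intro hc
    exact hm (by simp [FormMono.slot, hc])
  obtain ⟨e1, e2⟩ := h _ h2
  subst h1
  fin_cases i <;>
    simp_all [FormMono.degree, FormMono.picture, Fin.sum_univ_two, Function.update] <;> ring_nf <;>
    simp

theorem heaviside_bidegree (u : Symb) (h : u.heaviside.1 ≠ 0) :
    u.heaviside.2.degree = u.degree + -1 ∧ u.heaviside.2.picture = u.picture + -1 := by
  cases u with
  | pow a => exact absurd rfl h
  | delta l => simp [Symb.heaviside, Symb.degree, Symb.picture]; ring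

theorem eta_bidegree (u : Symb) (h : u.eta.1 ≠ 0) :
    u.eta.2.degree = u.degree + 1 ∧ u.eta.2.picture = u.picture + 1 := by
  rcases u with (a | l) | l
  · exact absurd rfl h
  · simp [Symb.eta, Symb.degree, Symb.picture, Int.negSucc_eq]
  · exact absurd rfl h

/-- The morphism `Ω^{k;p} ⟶ Ω^{k';p'}` given in both charts by an operator `τ` on the `i`-th symbol
that shifts degree and picture number by `d`. -/
def slotMap (i : Fin 2) (τ : Symb → ℂ × Symb) (d k p k' p' : ℤ)
    (hc : Frame.Commutes allForms allForms (FormMono.slot i τ))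
    (hd : ∀ u, (τ u).1 ≠ 0 → (τ u).2.degree = u.degree + d ∧ (τ u).2.picture = u.picture + d)
    (hk : k' = k + d) (hp : p' = p + d) : (forms k p).sheaf ⟶ (forms k' p').sheaf :=
  Frame.ofFrames (forms k p) (forms k' p') (Frame.subMap (FormMono.slot i τ) _ _)
    (hc.sub _ _
      (fun w m hm m' h => by
        obtain ⟨h1, h2⟩ := allForms_trans_bidegree w m m' h
        rwa [h1, h2])
      (fun m hm m' h => by
        obtain ⟨h1, h2⟩ := slot_bidegree i τ d hd m m' h
        rw [h1, h2, hm.1, hm.2]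
        exact ⟨hk.symm, hp.symm⟩))

/-- The morphism `Θᵢ = Θ(ι_θᵢ) : Ω^{k;p} ⟶ Ω^{k-1;p-1}`. -/
def thetaMap (i : Fin 2) (k p k' p' : ℤ) (hk : k' = k + -1) (hp : p' = p + -1) :
    (forms k p).sheaf ⟶ (forms k' p').sheaf :=
  slotMap i Symb.heaviside (-1) k p k' p'
    (slot_commutes i _ heaviside_weight heaviside_deriv) heaviside_bidegree hk hp

/-- The morphism `ηᵢ : Ω^{k;p} ⟶ Ω^{k+1;p+1}`. -/
def etaMap (i : Fin 2) (k p k' p' : ℤ) (hk : k' = k + 1) (hp : p' = p + 1) :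
    (forms k p).sheaf ⟶ (forms k' p').sheaf :=
  slotMap i Symb.eta 1 k p k' p'
    (slot_commutes i _ eta_weight eta_deriv) eta_bidegree hk hp

/-- `Θ_max = Θ₂ ∘ Θ₁ : Ω^{k;2} ⟶ Ω^{k-2;0}`. -/
def thetaMax (k : ℤ) : (forms k 2).sheaf ⟶ (forms (k - 2) 0).sheaf :=
  thetaMap 0 k 2 (k - 1) 1 (by ring) (by norm_num) ≫
    thetaMap 1 (k - 1) 1 (k - 2) 0 (by ring) (by norm_num)

/-- `η_max = η₁ ∘ η₂ : Ω^{k-2;0} ⟶ Ω^{k;2}`. -/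
def etaMax (k : ℤ) : (forms (k - 2) 0).sheaf ⟶ (forms k 2).sheaf :=
  etaMap 1 (k - 2) 0 (k - 1) 1 (by ring) (by norm_num) ≫
    etaMap 0 (k - 1) 1 k 2 (by ring) (by norm_num)

end SuperP12

end

noncomputable section

namespace SuperP12

/-! ### Charts -/

/-! The theorem rests on one identity: `Θ_max` followed by `η_max` is the identity of `Ω^{k;2}`
(`thetaMax_etaMax`). Picture number 2 forces both symbols of a frame member to be deltas, and on a
delta the constants `(-1)^l l!` and `(-1)^l / l!` of the two operators multiply to 1. So `Θ_max` is
a split monomorphism and `η_max` a split epimorphism. Formal consequences are injectivity,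
surjectivity, `ΘηΘ = Θ`, and the isomorphism of cokernel and kernel (`exists_cokernel_iso_kernel`).
The two negative statements follow from a nonzero section killed by `η_max`, namely a frame member
with the symbol `dθ₂⁰`: if `η_max` were mono or `Θ_max` epi, the splitting would make the two
morphisms mutually inverse.

Ranks and finite type need actual sections. The transition functions of the forms are holomorphic
for `w ≠ 0`, involve only finitely many members, and are given by the same formula in both
directions. This is packaged as `Regular`. It makes each frame member a section over its whole chart
(`Regular.basic`), and a section over an open subset of a chart is determined by its components
there. A finite frame is then a basis over every smaller open set, so the rank is a count of pairs
of deltas. With an infinite frame, finitely many sections involve only finitely many members near a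
point, and so miss some other member.

For `Φ`, the monomials of degree `1 - k` in `π∂_z` (odd, exponent at most 1), `π∂_θ₁`, `π∂_θ₂`
(even) are matched with pairs of deltas, with `dz` present exactly when `π∂_z` is absent. Expanding
the chain rule (`tangent_pi_monoTrans_zero`, `tangent_pi_monoTrans_one`) gives the same triangular
transition as Taylor expansion of the deltas, except that the diagonal entries have opposite signs.
Signs depending on the chart absorb this (`smul_monoTrans_apply`). -/

theorem pt_surjective : Function.Surjective pt := by
  intro x
  induction x using Projectivization.ind with
  | h v hv =>
    by_cases h0 : v 0 = 0
    · have h1 : v 1 ≠ 0 := fun h1 => hv (by funext j; fin_cases j <;> simp [h0, h1])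
      refine ⟨(1, 0), (Projectivization.mk_eq_mk_iff' ℂ _ _ _ _).2 ⟨(v 1)⁻¹, ?_⟩⟩
      funext j
      fin_cases j <;> simp [h0, h1]
    · refine ⟨(0, v 1 / v 0), (Projectivization.mk_eq_mk_iff' ℂ _ _ _ _).2 ⟨(v 0)⁻¹, ?_⟩⟩
      funext j
      fin_cases j <;> simp [h0]; ring

/-- The open set covered by one of the two charts. -/
def chartOpen (i : Fin 2) : Opens P1 where
  carrier := Set.range fun z : ℂ => pt (i, z)
  is_open' := by
    refine isOpen_coinduced.2 ?_
    -- In the quotient topology openness is tested on the preimage, which is the locus where the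
    -- `i`-th homogeneous coordinate is nonzero.
    have : (Projectivization.mk' ℂ ⁻¹' Set.range fun z : ℂ => pt (i, z)) =
        {v : {v : Fin 2 → ℂ // v ≠ 0} | v.1 i ≠ 0} := by
      ext ⟨v, hv⟩
      simp only [Set.mem_preimage, Set.mem_ofPred_eq, Projectivization.mk'_eq_mk]
      constructor
      · rintro ⟨z, hz⟩
        fin_cases i
        all_goals
          obtain ⟨a, ha⟩ := (Projectivization.mk_eq_mk_iff' ℂ _ _ _ _).1 hz
          intro h
          simp only [Fin.zero_eta, Fin.mk_one] at h
          have h0 := congrFun ha 0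
          have h1 := congrFun ha 1
          simp [h] at h0 h1
      · intro h
        fin_cases i
        · refine ⟨v 1 / v 0, (Projectivization.mk_eq_mk_iff' ℂ _ _ _ _).2 ⟨(v 0)⁻¹, ?_⟩⟩
          simp only [Fin.zero_eta] at h
          funext j
          fin_cases j <;> simp [h]; ring
        · refine ⟨v 0 / v 1, (Projectivization.mk_eq_mk_iff' ℂ _ _ _ _).2 ⟨(v 1)⁻¹, ?_⟩⟩
          simp only [Fin.mk_one] at h
          funext j
          fin_cases j <;> simp [h]; ring
    exact (congrArg IsOpen this).mpr
      (isOpen_ne_fun ((continuous_apply i).comp continuous_subtype_val) continuous_const)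

theorem pt_mem_chartOpen (y : ChartPt) : pt y ∈ chartOpen y.1 := ⟨y.2, rfl⟩

/-- The origin of the other chart is missed by this one, so on an open subset of one chart the other
coordinate can always be inverted. -/
theorem ne_zero_of_mem_chartOpen {i j : Fin 2} (hij : j ≠ i) {w : ℂ}
    (h : pt (j, w) ∈ chartOpen i) : w ≠ 0 := by
  rintro rfl
  obtain ⟨z, hz⟩ := h
  fin_cases i <;> fin_cases j <;> simp at hij
  all_goals
    obtain ⟨a, ha⟩ := (Projectivization.mk_eq_mk_iff' ℂ _ _ _ _).1 hz
    have h0 := congrFun ha 0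
    have h1 := congrFun ha 1
    simp at h0 h1

theorem pt_inv {i j : Fin 2} (hij : j ≠ i) {w : ℂ} (hw : w ≠ 0) : pt (i, w⁻¹) = pt (j, w) := by
  fin_cases i <;> fin_cases j <;> simp at hij
  · refine (Projectivization.mk_eq_mk_iff' ℂ _ _ _ _).2 ⟨w⁻¹, ?_⟩
    funext j
    fin_cases j <;> simp [hw]
  · refine (Projectivization.mk_eq_mk_iff' ℂ _ _ _ _).2 ⟨w⁻¹, ?_⟩
    funext j
    fin_cases j <;> simp [hw]

/-! ### Holomorphy and change of the odd coordinates -/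

theorem scale_scale {z w : ℂ} (h : z * w = 1) (a : Gr) : scale z (scale w a) = a := by
  have : (scale z).comp (scale w) = AlgHom.id ℂ Gr := by
    rw [scale, scale, ExteriorAlgebra.map_comp_map, ← ExteriorAlgebra.map_id]
    congr 1
    ext v
    have : z⁻¹ * w⁻¹ = 1 := by rw [← mul_inv, h, inv_one]
    simp [← mul_assoc, this]
  exact DFunLike.congr_fun this a

theorem HoloAt.sum {κ : Type*} (T : Finset κ) {F : κ → ℂ → Gr} {z₀ : ℂ}
    (h : ∀ k ∈ T, HoloAt (F k) z₀) : HoloAt (fun z => ∑ k ∈ T, F k z) z₀ := by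
  intro φ
  simp only [map_sum]
  exact Finset.analyticAt_fun_sum _ fun k hk => h k hk φ

theorem HoloAt.smul {f : ℂ → ℂ} {z₀ : ℂ} (hf : AnalyticAt ℂ f z₀) {F : ℂ → Gr}
    (hF : HoloAt F z₀) : HoloAt (fun z => f z • F z) z₀ := by
  intro φ
  simp only [map_smul, smul_eq_mul]
  exact hf.mul (hF φ)

theorem HoloAt.cst {f : ℂ → ℂ} {z₀ : ℂ} (hf : AnalyticAt ℂ f z₀) :
    HoloAt (fun z => cst (f z)) z₀ := by
  have : (fun z => SuperP12.cst (f z)) = fun z => f z • (1 : Gr) :=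
    funext fun z => Algebra.algebraMap_eq_smul_one _
  rw [this]
  exact HoloAt.smul hf (HoloAt.const 1 z₀)

theorem HoloAt.neg {F : ℂ → Gr} {z₀ : ℂ} (hF : HoloAt F z₀) : HoloAt (fun z => -F z) z₀ := by
  intro φ
  simp only [map_neg]
  exact (hF φ).neg

theorem HoloAt.congr {F G : ℂ → Gr} {z₀ : ℂ} (hF : HoloAt F z₀) (h : F =ᶠ[𝓝 z₀] G) :
    HoloAt G z₀ :=
  fun φ => (hF φ).congr (h.mono fun z hz => by simp only [hz])

theorem holoAt_scale_const (a : Gr) {w₀ : ℂ} (hw : w₀ ≠ 0) : HoloAt (fun w => scale w a) w₀ := by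
  induction a using ExteriorAlgebra.induction with
  | algebraMap r => simpa using HoloAt.const _ w₀
  | ι v =>
    have : (fun w : ℂ => scale w (ExteriorAlgebra.ι ℂ v)) =
        fun w => w⁻¹ • ExteriorAlgebra.ι ℂ v := by
      funext w
      simp [scale]
    rw [this]
    exact HoloAt.smul (analyticAt_id.inv hw) (HoloAt.const _ _)
  | mul a b ha hb => simpa using ha.mul hb
  | add a b ha hb => simpa using ha.add hb

/-- Here `w` enters both through the algebra map and through its argument. Expansion in the finite
monomial basis separates the two: scalar coefficients of `F w⁻¹` times `scale w` of fixed basis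
elements. -/
theorem HoloAt.scale_inv {F : ℂ → Gr} {w₀ : ℂ} (hw : w₀ ≠ 0) (hF : HoloAt F w₀⁻¹) :
    HoloAt (fun w => scale w (F w⁻¹)) w₀ := by
  let b := (Pi.basisFun ℂ (Fin 2)).ExteriorAlgebra
  have key : (fun w => scale w (F w⁻¹)) =
      fun w => ∑ I, b.coord I (F w⁻¹) • scale w (b I) := by
    funext w
    conv_lhs => rw [← b.sum_repr (F w⁻¹)]
    simp only [map_sum, map_smul, Module.Basis.coord_apply]
  rw [key]
  exact HoloAt.sum _ fun I _ => HoloAt.smul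
    ((hF (b.coord I)).comp_of_eq (analyticAt_id.inv hw) rfl) (holoAt_scale_const _ hw)

/-- A superfunction on an open subset of a chart is determined by its values in that chart. -/
theorem OSec.ext_chart {i : Fin 2} {V : Opens P1} (hV : V ≤ chartOpen i) {f g : OSec V}
    (h : ∀ z (hz : pt (i, z) ∈ V), f.1 ⟨(i, z), hz⟩ = g.1 ⟨(i, z), hz⟩) : f = g := by
  refine Subtype.ext (funext ?_)
  rintro ⟨⟨j, w⟩, hy⟩
  by_cases hij : j = i
  · subst hij
    exact h w hy
  · have hw := ne_zero_of_mem_chartOpen hij (hV hy)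
    have hy' : pt (i, w⁻¹) ∈ V := by rwa [pt_inv hij hw]
    have e := h _ hy'
    have hji : (i = 0 ∧ j = 1) ∨ (i = 1 ∧ j = 0) := by omega
    rcases hji with ⟨rfl, rfl⟩ | ⟨rfl, rfl⟩
    · have c : ∀ f : OSec V, _ := fun f => f.2.2 ⟨(0, w⁻¹), hy'⟩ ⟨(1, w), hy⟩ rfl rfl
        (inv_mul_cancel₀ hw)
      rw [c f, c g, e]
    -- The matching condition is stated only from `U₀` to `U₁`; in this direction it has to be
    -- undone by the inverse substitution.
    · have c : ∀ f : OSec V, _ := fun f => f.2.2 ⟨(0, w), hy⟩ ⟨(1, w⁻¹), hy'⟩ rfl rfl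
        (mul_inv_cancel₀ hw)
      rw [c f, c g] at e
      have := congrArg (scale w) e
      rwa [scale_scale (mul_inv_cancel₀ hw), scale_scale (mul_inv_cancel₀ hw)] at this

/-- A holomorphic function on an open subset of a chart is a superfunction. -/
theorem OSec.exists_of_chart {i : Fin 2} {V : Opens P1} (hV : V ≤ chartOpen i) (F : ℂ → Gr)
    (hF : ∀ z, pt (i, z) ∈ V → HoloAt F z) :
    ∃ f : OSec V, ∀ z (hz : pt (i, z) ∈ V), f.1 ⟨(i, z), hz⟩ = F z := by
  -- One formula extends `F` to the other chart for either value of `i`, because the change of odd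
  -- coordinates and its inverse have the same shape.
  refine ⟨⟨fun y => if y.1.1 = i then F y.1.2 else scale y.1.2 (F y.1.2⁻¹), ?_, ?_⟩,
    fun z hz => if_pos rfl⟩
  · rintro ⟨⟨j, w⟩, hy⟩
    by_cases hij : j = i
    · subst hij
      exact ⟨F, hF w hy, Filter.Eventually.of_forall fun z h => if_pos rfl⟩
    · have hw := ne_zero_of_mem_chartOpen hij (hV hy)
      exact ⟨fun w => scale w (F w⁻¹), HoloAt.scale_inv hw (hF _ (by rwa [pt_inv hij hw])),
        Filter.Eventually.of_forall fun z h => if_neg hij⟩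
  · rintro ⟨⟨_, z⟩, hz⟩ ⟨⟨_, w⟩, hw⟩ h0 h1 h
    simp only at h0 h1 h
    subst h0 h1
    have hi : i = 0 ∨ i = 1 := by omega
    rcases hi with rfl | rfl
    · simp [eq_inv_of_mul_eq_one_left h]
    · have hw : z⁻¹ = w := (eq_inv_of_mul_eq_one_right h).symm
      simp [hw, scale_scale (mul_comm z w ▸ h)]

/-! ### Frames with mutually inverse holomorphic transition functions -/

namespace Frame

variable {ι κ : Type}

theorem transport_single_one (E : Frame ι) (w : ℂ) (m : ι) :
    E.transport w (Finsupp.single m 1) = E.trans w m := by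
  simp [transport]

/-- The transition functions are holomorphic, locally finite, and given by the same formulas in
both directions. -/
structure Regular (E : Frame ι) : Prop where
  symm : ∀ {z w : ℂ}, z * w = 1 → ∀ m, E.transport z (E.trans w m) = Finsupp.single m 1
  holo : ∀ {w : ℂ}, w ≠ 0 → ∀ m m', HoloAt (fun w => E.trans w m m') w
  fin : ∀ m, ∃ T : Finset ι, ∀ w, (E.trans w m).support ⊆ T

theorem Regular.transport_transport {E : Frame ι} (hE : E.Regular) {z w : ℂ} (h : z * w = 1)
    (c : ι →₀ Gr) : E.transport z (E.transport w c) = c := by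
  induction c using Finsupp.induction_linear with
  | zero => simp
  | add c d hc hd => rw [transport_add, transport_add, hc, hd]
  | single m a =>
    have e : Finsupp.single m a = a • Finsupp.single m (1 : Gr) := by simp
    rw [e, transport_smul, transport_smul, transport_single_one, hE.symm h, scale_scale h]

/-- A section over an open subset of a chart is determined by its components in that chart. -/
theorem Regular.sec_ext {E : Frame ι} (hE : E.Regular) {i : Fin 2} {V : Opens P1}
    (hV : V ≤ chartOpen i) {s t : E.Sec V}
    (h : ∀ z (hz : pt (i, z) ∈ V), s.1 ⟨(i, z), hz⟩ = t.1 ⟨(i, z), hz⟩) : s = t := by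
  refine Subtype.ext (funext ?_)
  rintro ⟨⟨j, w⟩, hy⟩
  by_cases hij : j = i
  · subst hij
    exact h w hy
  · have hw := ne_zero_of_mem_chartOpen hij (hV hy)
    have hy' : pt (i, w⁻¹) ∈ V := by rwa [pt_inv hij hw]
    have e := h _ hy'
    have hji : (i = 0 ∧ j = 1) ∨ (i = 1 ∧ j = 0) := by omega
    rcases hji with ⟨rfl, rfl⟩ | ⟨rfl, rfl⟩
    · have c : ∀ f : E.Sec V, _ := fun f => f.2.2.2 ⟨(0, w⁻¹), hy'⟩ ⟨(1, w), hy⟩ rfl rfl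
        (inv_mul_cancel₀ hw)
      rw [c s, c t, e]
    · have c : ∀ f : E.Sec V, _ := fun f => f.2.2.2 ⟨(0, w), hy⟩ ⟨(1, w⁻¹), hy'⟩ rfl rfl
        (mul_inv_cancel₀ hw)
      rw [c s, c t] at e
      have := congrArg (E.transport w) e
      rwa [hE.transport_transport (mul_inv_cancel₀ hw),
        hE.transport_transport (mul_inv_cancel₀ hw)] at this

instance (E : Frame ι) (V : Opens P1) : AddCommGroup (E.Sec V) := (E.Sec V).addCommGroup

instance (E : Frame ι) (V : Opens P1) : Module (OSec V) (E.Sec V) := (E.Sec V).module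

instance (E : Frame ι) (V : Opens P1) : SMul (OSec V) (E.Sec V) :=
  (E.Sec V).module.toDistribMulAction.toMulAction.toSMul

/-- The members of the frame of a chart, as sections. -/
def Regular.basic {E : Frame ι} (hE : E.Regular) (i : Fin 2) (m : ι) : E.Sec (chartOpen i) :=
  ⟨fun y => if y.1.1 = i then Finsupp.single m 1 else E.trans y.1.2 m, by
    classical
    refine ⟨?_, ?_, ?_⟩
    · rintro m' ⟨⟨j, w⟩, hy⟩
      by_cases hij : j = i
      · exact ⟨_, HoloAt.const (Finsupp.single m (1 : Gr) m') w,
          Filter.Eventually.of_forall fun z h => by simp [hij]⟩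
      · exact ⟨_, hE.holo (ne_zero_of_mem_chartOpen hij hy) m m',
          Filter.Eventually.of_forall fun z h => by simp [hij]⟩
    · rintro ⟨⟨j, w⟩, hy⟩
      obtain ⟨T, hT⟩ := hE.fin m
      refine ⟨insert m T, Filter.Eventually.of_forall fun z h => ?_⟩
      by_cases hij : j = i
      · simp only [hij, if_true]
        exact Finsupp.support_single_subset.trans (by simp)
      · simp only [hij, if_false]
        exact (hT z).trans (Finset.subset_insert _ _)
    · rintro ⟨⟨_, z⟩, hz⟩ ⟨⟨_, w⟩, hw⟩ h0 h1 h
      simp only at h0 h1 h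
      subst h0 h1
      have hi : i = 0 ∨ i = 1 := by omega
      rcases hi with rfl | rfl
      · simp [transport_single_one]
      · simp [hE.symm (mul_comm z w ▸ h)]⟩

theorem Regular.basic_apply {E : Frame ι} (hE : E.Regular) (i : Fin 2) (m : ι) (z : ℂ)
    (hz : pt (i, z) ∈ chartOpen i) :
    (hE.basic i m).1 ⟨(i, z), hz⟩ = Finsupp.single m 1 := if_pos rfl

theorem Regular.basic_restrict_apply {E : Frame ι} (hE : E.Regular) (i : Fin 2) (m : ι)
    {V : Opens P1} (hV : V ≤ chartOpen i) (z : ℂ) (hz : pt (i, z) ∈ V) :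
    (Sec.restrict E hV (hE.basic i m)).1 ⟨(i, z), hz⟩ = Finsupp.single m 1 := if_pos rfl

/-- The value of a section at a chart point, as an additive map. -/
def evalAt (E : Frame ι) {V : Opens P1} (y : Pts V) : E.Sec V →+ (ι →₀ Gr) where
  toFun s := s.1 y
  map_zero' := rfl
  map_add' _ _ := rfl

theorem evalAt_smul (E : Frame ι) {V : Opens P1} (y : Pts V) (f : OSec V) (s : E.Sec V) :
    E.evalAt y (f • s) = f.1 y • E.evalAt y s := rfl

/-- In its own chart a basic section is a constant unit vector, so coefficients can be read off as
components. Both independence and spanning come from this. -/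
theorem Regular.evalAt_sum {E : Frame ι} (hE : E.Regular) [Fintype κ] (e : κ ≃ ι) {i : Fin 2}
    {V : Opens P1} (hV : V ≤ chartOpen i) (f : κ → OSec V) (z : ℂ) (hz : pt (i, z) ∈ V) (k : κ) :
    (∑ l, f l • Sec.restrict E hV (hE.basic i (e l))).1 ⟨(i, z), hz⟩ (e k) =
      (f k).1 ⟨(i, z), hz⟩ := by
  classical
  have := map_sum (E.evalAt ⟨(i, z), hz⟩)
    (fun l => f l • Sec.restrict E hV (hE.basic i (e l))) Finset.univ
  have h2 := DFunLike.congr_fun this (e k)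
  refine h2.trans ?_
  rw [Finsupp.finsetSum_apply, Finset.sum_eq_single k]
  · rw [evalAt_smul]
    change (f k).1 _ * (Sec.restrict E hV (hE.basic i (e k))).1 ⟨(i, z), hz⟩ (e k) = _
    rw [hE.basic_restrict_apply]
    simp
  · intro l _ hl
    rw [evalAt_smul]
    change (f l).1 _ * (Sec.restrict E hV (hE.basic i (e l))).1 ⟨(i, z), hz⟩ (e k) = _
    rw [hE.basic_restrict_apply, Finsupp.single_eq_of_ne (fun h => hl (e.injective h).symm),
      mul_zero]
  · simp

theorem Regular.linearIndependent {E : Frame ι} (hE : E.Regular) [Fintype κ] (e : κ ≃ ι)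
    {i : Fin 2} {V : Opens P1} (hV : V ≤ chartOpen i) :
    LinearIndependent (OSec V) fun k => Sec.restrict E hV (hE.basic i (e k)) := by
  rw [Fintype.linearIndependent_iff]
  intro f hf k
  refine OSec.ext_chart hV fun z hz => ?_
  rw [← hE.evalAt_sum e hV f z hz k, hf]
  rfl

theorem Regular.span_eq_top {E : Frame ι} (hE : E.Regular) [Fintype κ] (e : κ ≃ ι)
    {i : Fin 2} {V : Opens P1} (hV : V ≤ chartOpen i) :
    Submodule.span (OSec V) (Set.range fun k => Sec.restrict E hV (hE.basic i (e k))) = ⊤ := by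
  classical
  refine eq_top_iff.2 fun s _ => ?_
  have hex : ∀ k, ∃ f : OSec V, ∀ z (hz : pt (i, z) ∈ V),
      f.1 ⟨(i, z), hz⟩ = s.1 ⟨(i, z), hz⟩ (e k) := by
    intro k
    obtain ⟨f, hf⟩ := OSec.exists_of_chart hV
      (fun z => if hz : pt (i, z) ∈ V then s.1 ⟨(i, z), hz⟩ (e k) else 0) (by
        intro z hz
        obtain ⟨F, hF, eF⟩ := s.2.1 (e k) ⟨(i, z), hz⟩
        refine hF.congr ?_
        filter_upwards [eF, eventually_mem (V := V) ⟨(i, z), hz⟩] with z' h1 h2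
        rw [dif_pos h2, h1 h2])
    exact ⟨f, fun z hz => (hf z hz).trans (dif_pos hz)⟩
  choose f hf using hex
  have : s = ∑ k, f k • Sec.restrict E hV (hE.basic i (e k)) := by
    refine hE.sec_ext hV fun z hz => Finsupp.ext fun m => ?_
    obtain ⟨k, rfl⟩ := e.surjective m
    rw [hE.evalAt_sum e hV f z hz k, hf]
  rw [this]
  exact Submodule.sum_mem _ fun k _ => Submodule.smul_mem _ _ (Submodule.subset_span ⟨k, rfl⟩)

/-- The basic sections are homogeneous when the transition functions preserve parity. -/
theorem Regular.isHomog_basic {E : Frame ι} (hE : E.Regular)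
    (hp : ∀ w m m', E.trans w m m' ∈ grPart (E.parity m - E.parity m')) (i : Fin 2) (m : ι) :
    IsHomog (E.parity m) (hE.basic i m) := by
  classical
  intro y m'
  change (if y.1.1 = i then Finsupp.single m (1 : Gr) else E.trans y.1.2 m) m' ∈ _
  split_ifs
  · by_cases h : m' = m
    · subst h
      rw [Finsupp.single_eq_same, sub_self]
      exact SetLike.GradedOne.one_mem (A := CliffordAlgebra.evenOdd _)
    · rw [Finsupp.single_eq_of_ne h]
      exact zero_mem _
  · exact hp _ _ _

theorem Regular.isLocallyFreeOfRank {E : Frame ι} (hE : E.Regular)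
    (hp : ∀ w m m', E.trans w m m' ∈ grPart (E.parity m - E.parity m')) {p q : ℕ}
    (e : Fin p ⊕ Fin q ≃ ι) (h0 : ∀ i, E.parity (e (Sum.inl i)) = 0)
    (h1 : ∀ j, E.parity (e (Sum.inr j)) = 1) : IsLocallyFreeOfRank E p q := by
  intro x
  obtain ⟨y, rfl⟩ := pt_surjective x
  refine ⟨chartOpen y.1, pt_mem_chartOpen y, fun k => hE.basic y.1 (e k), fun i => ?_, fun j => ?_,
    fun V hV => ⟨hE.linearIndependent e hV, hE.span_eq_top e hV⟩⟩
  · exact h0 i ▸ hE.isHomog_basic hp _ _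
  · exact h1 j ▸ hE.isHomog_basic hp _ _

/-- A sheaf with an infinite frame is nowhere of finite type. -/
theorem Regular.not_isFiniteTypeAt {E : Frame ι} (hE : E.Regular) [Infinite ι] (x : P1) :
    ¬ IsFiniteTypeAt E x := by
  classical
  rintro ⟨U, hxU, n, t, ht⟩
  obtain ⟨y, rfl⟩ := pt_surjective x
  -- Local finiteness bounds the members occurring in each of the finitely many generators near the
  -- point, so an infinite frame has a member `m` that occurs in none.
  choose T hT using fun i => (t i).2.2.1 ⟨y, hxU⟩
  obtain ⟨m, hm⟩ := Infinite.exists_notMem_finset (Finset.univ.biUnion T)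
  obtain ⟨W, hyW, hW, hs⟩ := ht (U ⊓ chartOpen y.1) inf_le_left
    (Sec.restrict E inf_le_right (hE.basic y.1 m)) (pt y) ⟨hxU, pt_mem_chartOpen y⟩
  -- The `m`-th component at the chart point `y` vanishes on all combinations of the generators, but
  -- it is 1 on the basic section of `m`.
  have key : ∀ s ∈ Submodule.span (OSec W)
      (Set.range fun i => Sec.restrict E (hW.trans inf_le_left) (t i)),
      s.1 ⟨y, hyW⟩ m = 0 := by
    intro s hs
    induction hs using Submodule.span_induction with
    | mem s hs =>
      obtain ⟨i, rfl⟩ := hs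
      have h1 := (hT i).self_of_nhds hxU
      refine Finsupp.notMem_support_iff.1 fun h2 => hm ?_
      exact Finset.mem_biUnion.2 ⟨i, Finset.mem_univ _, h1 h2⟩
    | zero => rfl
    | add s t _ _ hs ht =>
      change s.1 _ m + t.1 _ m = 0
      rw [hs, ht, add_zero]
    | smul a s _ hs =>
      change a.1 _ * s.1 _ m = 0
      rw [hs, mul_zero]
  have h1 := key _ hs
  have h2 : (hE.basic y.1 m).1 ⟨y, pt_mem_chartOpen y⟩ m = 0 := h1
  rw [hE.basic_apply] at h2
  simp at h2

theorem Regular.basic_ne_zero {E : Frame ι} (hE : E.Regular) (i : Fin 2) (m : ι) :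
    hE.basic i m ≠ 0 := by
  intro h
  have h2 := congrArg (fun s : E.Sec (chartOpen i) => s.1 ⟨(i, 0), pt_mem_chartOpen (i, 0)⟩ m) h
  simp only [hE.basic_apply] at h2
  simp at h2

end Frame

/-! ### Regularity of the sheaves of forms -/

namespace Frame

variable {ι : Type}

theorem transport_single (E : Frame ι) (w : ℂ) (m : ι) (a : Gr) :
    E.transport w (Finsupp.single m a) = scale w a • E.trans w m := by
  simp [transport]

theorem transport_sub (E : Frame ι) (w : ℂ) (c d : ι →₀ Gr) :
    E.transport w (c - d) = E.transport w c - E.transport w d := by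
  rw [eq_sub_iff_add_eq, ← transport_add, sub_add_cancel]

theorem transport_sum {κ : Type*} (E : Frame ι) (w : ℂ) (T : Finset κ) (c : κ → ι →₀ Gr) :
    E.transport w (∑ k ∈ T, c k) = ∑ k ∈ T, E.transport w (c k) :=
  map_sum (⟨⟨E.transport w, E.transport_zero w⟩, E.transport_add w⟩ : (ι →₀ Gr) →+ (ι →₀ Gr)) c T

theorem sub_transport (E : Frame ι) (P : ι → Prop) (w : ℂ) (c : ι →₀ Gr)
    (hc : ∀ m, c m ≠ 0 → P m) :
    (E.sub P).transport w (c.subtypeDomain P) = (E.transport w c).subtypeDomain P := by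
  have h := linearCombination_sub (E.trans w) P P (c.mapRange (scale w) (map_zero _))
    fun m hm => hc m fun h => hm (by simp [h])
  have e : (c.subtypeDomain P).mapRange (scale w) (map_zero _) =
      (c.mapRange (scale w) (map_zero _)).subtypeDomain P := Finsupp.ext fun _ => rfl
  rw [transport, transport, ← h, e]
  rfl

/-- Stability of `P` under the transitions means that truncating to `P` drops no component, so the
inverse relation survives. -/
theorem Regular.sub {E : Frame ι} (hE : E.Regular) (P : ι → Prop)
    (hP : ∀ w m, P m → ∀ m', E.trans w m m' ≠ 0 → P m') : (E.sub P).Regular where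
  symm {z w} h m := by
    have h1 := sub_transport E P z (E.trans w m.1) (hP w m.1 m.2)
    rw [hE.symm h] at h1
    refine h1.trans (Finsupp.ext fun m' => ?_)
    rw [Finsupp.subtypeDomain_apply]
    by_cases hm : m' = m
    · rw [hm, Finsupp.single_eq_same, Finsupp.single_eq_same]
    · rw [Finsupp.single_eq_of_ne hm, Finsupp.single_eq_of_ne fun h => hm (Subtype.ext h)]
  holo hw m m' := hE.holo hw m.1 m'.1
  fin m := by
    classical
    obtain ⟨T, hT⟩ := hE.fin m.1
    refine ⟨T.subtype P, fun w m' hm' => ?_⟩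
    rw [Finset.mem_subtype]
    have : (E.sub P).trans w m m' ≠ 0 := Finsupp.mem_support_iff.1 hm'
    change E.trans w m.1 m'.1 ≠ 0 at this
    exact hT w (Finsupp.mem_support_iff.2 this)

end Frame

theorem Symb.weight_deriv (u : Symb) : u.deriv.2.weight = u.weight + 1 := by
  cases u <;> simp [Symb.deriv, Symb.weight]; ring

theorem Symb.parity_deriv (u : Symb) : u.deriv.2.parity = u.parity := by
  cases u <;> rfl

theorem FormMono.weight_deriv (ε ε' : Bool) (u : Fin 2 → Symb) (i : Fin 2) :
    FormMono.weight (ε, Function.update u i (u i).deriv.2) = FormMono.weight (ε', u) + 1 := by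
  fin_cases i <;> simp [FormMono.weight, Fin.sum_univ_two, Symb.weight_deriv] <;> ring

theorem scale_cst_mul_theta (z c : ℂ) (i : Fin 2) :
    scale z (cst c * theta i) = cst (c * z⁻¹) * theta i := by
  simp [scale, theta, Algebra.algebraMap_eq_smul_one, smul_smul]

theorem theta_mul_cst (c : ℂ) (i : Fin 2) : theta i * cst c = cst c * theta i :=
  (Algebra.commutes c (theta i)).symm

theorem allForms_trans_true (w : ℂ) (u : Fin 2 → Symb) :
    allForms.trans w (true, u) =
      Finsupp.single (true, u) (cst (-w ^ (FormMono.weight (true, u) - 2))) := rfl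

theorem allForms_trans_false (w : ℂ) (u : Fin 2 → Symb) :
    allForms.trans w (false, u) =
      Finsupp.single (false, u) (cst (w ^ FormMono.weight (false, u))) -
        ∑ i, Finsupp.single (true, Function.update u i (u i).deriv.2)
          (cst ((u i).deriv.1 * w ^ (FormMono.weight (false, u) - 1)) * theta i) := rfl

/-- The two charts play symmetric roles, so the transition formula at `z = w⁻¹` inverts the one at
`w`. Diagonal entries are mutually inverse powers; for members without `dz`, the two contributions
to each first-order Taylor term cancel. -/
theorem allForms_regular : allForms.Regular where
  symm {z w} h m := by
    have hw : w ≠ 0 := right_ne_zero_of_mul_eq_one h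
    obtain rfl : z = w⁻¹ := eq_inv_of_mul_eq_one_left h
    obtain ⟨_ | _, u⟩ := m
    · rw [allForms_trans_false, Frame.transport_sub, Frame.transport_sum, Frame.transport_single,
        allForms_trans_false, smul_sub, Finset.smul_sum, sub_sub, ← Finset.sum_add_distrib,
        Finset.sum_eq_zero, sub_zero]
      · rw [AlgHom.commutes, Finsupp.smul_single, smul_eq_mul, ← map_mul, inv_zpow,
          mul_inv_cancel₀ (zpow_ne_zero _ hw), map_one]
      · intro i _
        rw [Frame.transport_single, scale_cst_mul_theta, allForms_trans_true, AlgHom.commutes,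
          Finsupp.smul_single, Finsupp.smul_single, ← Finsupp.single_add, smul_eq_mul, smul_eq_mul,
          ← mul_assoc, mul_assoc _ (theta i), theta_mul_cst, ← mul_assoc, ← map_mul,
          ← map_mul, ← add_mul, ← map_add, FormMono.weight_deriv true false]
        have e1 : w ^ (FormMono.weight (false, u)) = w ^ (FormMono.weight (false, u) - 1) * w := by
          rw [zpow_sub_one₀ hw, inv_mul_cancel_right₀ hw]
        have e2 : FormMono.weight (false, u) + 1 - 2 = FormMono.weight (false, u) - 1 := by ring
        -- With `n` the weight, `p = w ^ (n - 1)`, `q = w⁻¹ ^ (n - 1)` and `d` is the derivative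
        -- coefficient. In the second summand the factor `w` comes from rescaling `θᵢ`, and the sign
        -- from `dz = -w⁻² dw`.
        have e3 : ∀ p d q : ℂ, p * w * (d * q) + d * p * w * -q = 0 := fun p d q => by ring
        rw [e1, e2, inv_inv, e3, map_zero, zero_mul, Finsupp.single_zero]
    · rw [allForms_trans_true, Frame.transport_single, allForms_trans_true, AlgHom.commutes,
        Finsupp.smul_single, smul_eq_mul, ← map_mul, inv_zpow, neg_mul_neg,
        mul_inv_cancel₀ (zpow_ne_zero _ hw), map_one]
  holo {w} hw m m' := by
    classical
    have hz : ∀ n : ℤ, AnalyticAt ℂ (fun w : ℂ => w ^ n) w := fun n => analyticAt_id.zpow hw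
    have hs : ∀ (n : FormMono) (f : ℂ → Gr), HoloAt f w →
        HoloAt (fun w => Finsupp.single n (f w) m') w := by
      intro n f hf
      by_cases h : m' = n
      · subst h
        simpa using hf
      · simpa [Finsupp.single_eq_of_ne h] using HoloAt.const 0 w
    obtain ⟨_ | _, u⟩ := m
    · simp only [allForms_trans_false, sub_eq_add_neg, Finsupp.add_apply, Finsupp.neg_apply,
        Finsupp.finsetSum_apply]
      refine (hs _ _ (HoloAt.cst (hz _))).add (HoloAt.neg (HoloAt.sum _ fun i _ => hs _ _ ?_))
      exact (HoloAt.cst (analyticAt_const.mul (hz _))).mul (HoloAt.const _ _)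
    · exact hs _ _ (HoloAt.cst (hz _).neg)
  fin m := by
    classical
    obtain ⟨ε, u⟩ := m
    refine ⟨insert (ε, u) (Finset.univ.image fun i => (true, Function.update u i (u i).deriv.2)),
      fun w => ?_⟩
    cases ε
    · rw [allForms_trans_false]
      refine Finsupp.support_sub.trans (Finset.union_subset ?_ ?_)
      · exact Finsupp.support_single_subset.trans (by simp)
      · refine Finsupp.support_finsetSum.trans (Finset.biUnion_subset.2 fun i _ => ?_)
        exact Finsupp.support_single_subset.trans (by simp)
    · exact Finsupp.support_single_subset.trans (by simp)

theorem forms_regular (k p : ℤ) : (forms k p).Regular :=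
  allForms_regular.sub _ fun w m hm m' h => by
    obtain ⟨h1, h2⟩ := allForms_trans_bidegree w m m' h
    rwa [h1, h2]

/-! ### Parity of the transition functions -/

theorem cst_mem_grPart (c : ℂ) : cst c ∈ grPart 0 :=
  SetLike.algebraMap_mem_graded (CliffordAlgebra.evenOdd (0 : QuadraticForm ℂ (Fin 2 → ℂ))) c

theorem cst_mul_theta_mem_grPart (c : ℂ) (i : Fin 2) : cst c * theta i ∈ grPart 1 := by
  rw [← Algebra.smul_def]
  exact Submodule.smul_mem _ _ (CliffordAlgebra.ι_mem_evenOdd_one _ _)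

theorem single_apply_mem_grPart {ι : Type} {q : ι → ZMod 2} {n : ι} {a : Gr}
    (h : a ∈ grPart (q n)) (m : ι) : Finsupp.single n a m ∈ grPart (q m) := by
  classical
  by_cases hm : m = n
  · subst hm
    simpa using h
  · rw [Finsupp.single_eq_of_ne hm]
    exact zero_mem _

/-- Differentiating a symbol keeps its parity; the new odd factor `dw` in a Taylor term is
compensated by its odd coefficient `θᵢ`. -/
theorem allForms_trans_mem_grPart (w : ℂ) (m m' : FormMono) :
    allForms.trans w m m' ∈ grPart (allForms.parity m - allForms.parity m') := by
  obtain ⟨_ | _, u⟩ := m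
  · rw [allForms_trans_false, Finsupp.sub_apply, Finsupp.finsetSum_apply]
    refine sub_mem ?_ (sum_mem fun i _ => ?_)
    · refine single_apply_mem_grPart (q := fun m => allForms.parity (false, u) - allForms.parity m)
        ?_ m'
      rw [sub_self]
      exact cst_mem_grPart _
    · refine single_apply_mem_grPart (q := fun m => allForms.parity (false, u) - allForms.parity m)
        ?_ m'
      convert cst_mul_theta_mem_grPart _ _
      have : ∀ a b : ZMod 2, a + b - (1 + (a + b)) = 1 := by decide
      fin_cases i <;>
        simp [allForms, Fin.sum_univ_two, Symb.parity_deriv, this]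
  · rw [allForms_trans_true]
    refine single_apply_mem_grPart (q := fun m => allForms.parity (true, u) - allForms.parity m)
      ?_ m'
    rw [sub_self]
    exact cst_mem_grPart _

theorem forms_trans_mem_grPart (k p : ℤ) (w : ℂ) (m m') :
    (forms k p).trans w m m' ∈ grPart ((forms k p).parity m - (forms k p).parity m') :=
  allForms_trans_mem_grPart w m.1 m'.1

/-! ### Frame members of given degree and picture number -/

/-- Each of the two slots contributes at most 1 to the picture number, so total 2 leaves no room for
a power. -/
theorem exists_delta_of_picture {m : FormMono} (h : m.picture = 2) :
    ∃ l : Fin 2 → ℕ, m.2 = fun i => Symb.delta (l i) := by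
  obtain ⟨ε, u⟩ := m
  have : ∀ i, ∃ l, u i = Symb.delta l := by
    intro i
    simp only [FormMono.picture, Fin.sum_univ_two] at h
    rcases h0 : u 0 with a | a <;> rcases h1 : u 1 with b | b <;>
      simp [h0, h1, Symb.picture] at h
    fin_cases i <;> simp [h0, h1]
  choose l hl using this
  exact ⟨l, funext hl⟩

/-- Negative powers are allowed, so raising the exponent of `dθ₁` can always be balanced by lowering
that of `dθ₂`. -/
instance (k : ℤ) : Infinite {m : FormMono // m.degree = k ∧ m.picture = 0} :=
  Infinite.of_injective
    (fun a : ℕ => (⟨(true, ![Symb.pow a, Symb.pow (k - 1 - a)]), by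
      simp [FormMono.degree, Fin.sum_univ_two, Symb.degree], by
      simp [FormMono.picture, Symb.picture]⟩ :
        {m : FormMono // m.degree = k ∧ m.picture = 0}))
    (fun a b h => by
      have := congrFun (congrArg (fun m => m.1.2) h) 0
      simpa using this)

/-- The members of the frame of the integral forms, the even ones first. -/
def integralIndex (k : ℤ) (hk : k ≤ 1) : Fin (1 - k).toNat ⊕ Fin (2 - k).toNat →
    {m : FormMono // m.degree = k ∧ m.picture = 2}
  -- Without `dz` the orders of the deltas add up to `-k`, with `dz` to `1 - k`. The bound on `j`
  -- keeps the natural subtraction from truncating.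
  | Sum.inl j => ⟨(false, ![Symb.delta j, Symb.delta ((-k).toNat - j)]), by
      have := j.2
      simp [FormMono.degree, Fin.sum_univ_two, Symb.degree]
      omega, by
      simp [FormMono.picture, Fin.sum_univ_two, Symb.picture]⟩
  | Sum.inr j => ⟨(true, ![Symb.delta j, Symb.delta ((1 - k).toNat - j)]), by
      have := j.2
      simp [FormMono.degree, Fin.sum_univ_two, Symb.degree]
      omega, by
      simp [FormMono.picture, Fin.sum_univ_two, Symb.picture]⟩

theorem integralIndex_bijective (k : ℤ) (hk : k ≤ 1) :
    Function.Bijective (integralIndex k hk) := by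
  constructor
  · rintro (a | a) (b | b) h <;> have h1 := congrArg (fun m => m.1.1) h <;>
      have h2 := congrFun (congrArg (fun m => m.1.2) h) 0 <;>
      simp [integralIndex] at h1 h2
    · rw [Fin.ext h2]
    · rw [Fin.ext h2]
  · rintro ⟨⟨ε, u⟩, hd, hp⟩
    obtain ⟨l, rfl⟩ : ∃ l : Fin 2 → ℕ, u = _ := exists_delta_of_picture hp
    simp [FormMono.degree, Fin.sum_univ_two, Symb.degree] at hd
    cases ε
    · refine ⟨Sum.inl ⟨l 0, by simp at hd; omega⟩, Subtype.ext (Prod.ext rfl (funext fun i => ?_))⟩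
      fin_cases i <;> simp [integralIndex] at hd ⊢
      omega
    · refine ⟨Sum.inr ⟨l 0, by simp at hd; omega⟩, Subtype.ext (Prod.ext rfl (funext fun i => ?_))⟩
      fin_cases i <;> simp [integralIndex] at hd ⊢
      omega

theorem isLocallyFreeOfRank_integralForms (k : ℤ) (hk : k ≤ 1) :
    Frame.IsLocallyFreeOfRank (forms k 2) (1 - k).toNat (2 - k).toNat := by
  refine (forms_regular k 2).isLocallyFreeOfRank (forms_trans_mem_grPart k 2)
    (Equiv.ofBijective _ (integralIndex_bijective k hk)) (fun j => ?_) fun j => ?_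
  · simp [forms, Frame.sub, allForms, integralIndex, Fin.sum_univ_two, Symb.parity]
    decide
  · simp [forms, Frame.sub, allForms, integralIndex, Fin.sum_univ_two, Symb.parity]
    decide

/-! ### Split monomorphisms -/

/-- The kernel of a retraction is isomorphic to the cokernel of its section. -/
theorem exists_cokernel_iso_kernel {C : Type*} [Category C] [Preadditive C] {X Y : C} {f : X ⟶ Y}
    {g : Y ⟶ X} [HasCokernel f] [HasKernel g] (h : f ≫ g = 𝟙 X) :
    ∃ e : cokernel f ≅ kernel g, e.inv = kernel.ι g ≫ cokernel.π f :=
  -- The map `𝟙 - g ≫ f` is the projection onto the kernel of `g` along the image of `f`: it is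
  -- killed by `g` and kills `f`.
  ⟨{ hom := cokernel.desc f (kernel.lift g (𝟙 Y - g ≫ f) (by simp [h])) (by
        rw [← cancel_mono (kernel.ι g)]
        simp [reassoc_of% h])
     inv := kernel.ι g ≫ cokernel.π f
     hom_inv_id := by
        rw [← cancel_epi (cokernel.π f)]
        simp
     inv_hom_id := by
        rw [← cancel_mono (kernel.ι g)]
        simp }, rfl⟩

/-! ### Morphisms of sheaves of sections of frames -/

namespace Frame

variable {ι κ μ : Type} {E : Frame ι} {F : Frame κ} {G : Frame μ}

theorem hom_ext {f g : E.sheaf ⟶ F.sheaf} (h : ∀ U s, onSec f U s = onSec g U s) : f = g := by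
  refine SheafOfModules.hom_ext (PresheafOfModules.hom_ext fun U => ?_)
  ext s
  exact h U.unop s

theorem HasParity.comp {f : E.sheaf ⟶ F.sheaf} {g : F.sheaf ⟶ G.sheaf} {a b : ZMod 2}
    (hf : HasParity a f) (hg : HasParity b g) : HasParity (a + b) (f ≫ g) := by
  intro U q s hs
  rw [← add_assoc]
  exact hg U _ _ (hf U q s hs)

theorem mul_cst_mem_grPart {a : Gr} {q : ZMod 2} (h : a ∈ grPart q) (c : ℂ) :
    a * cst c ∈ grPart q := by
  rw [← Algebra.commutes, ← Algebra.smul_def]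
  exact Submodule.smul_mem _ _ h

theorem hasParity_ofFrames {φ : ι → κ →₀ ℂ} (hφ : Commutes E F φ) {d : ZMod 2}
    (h : ∀ m k, φ m k ≠ 0 → F.parity k = E.parity m + d) : HasParity d (ofFrames E F φ hφ) := by
  intro U q s hs y k
  change extend φ (s.1 y) k ∈ _
  rw [extend_apply φ _ _ subset_rfl]
  refine sum_mem fun m _ => ?_
  by_cases hm : φ m k = 0
  · rw [hm, map_zero, mul_zero]
    exact zero_mem _
  · rw [h m k hm, add_sub_add_right_eq_sub]
    exact mul_cst_mem_grPart (hs y m) _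

/-! ### Isomorphisms that rescale the members of the frames -/

/-- The map on frames that relabels the members and multiplies them by constants. -/
def relabel (e : ι ≃ κ) (c : ι → ℂ) (m : ι) : κ →₀ ℂ := Finsupp.single (e m) (c m)

theorem extend_relabel (e : ι ≃ κ) (c : ι → ℂ) (x : ι →₀ Gr) (k : κ) :
    extend (relabel e c) x k = c (e.symm k) • x (e.symm k) := by
  induction x using Finsupp.induction_linear with
  | zero => simp
  | add x y hx hy => rw [map_add, Finsupp.add_apply, hx, hy, Finsupp.add_apply, smul_add]
  | single m a =>
    have h1 : extend (relabel e c) (Finsupp.single m a) = Finsupp.single (e m) (c m • a) := by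
      simp [extend, relabel, Algebra.smul_def, Algebra.commutes]
    rw [h1]
    by_cases hk : k = e m
    · subst hk
      simp
    · rw [Finsupp.single_eq_of_ne hk, Finsupp.single_eq_of_ne fun h => hk (by simp [← h]),
        smul_zero]

/-- Relabelling and rescaling, by constants that depend on the chart, matches the transition
functions. -/
def RelabelCommutes (E : Frame ι) (F : Frame κ) (e : ι ≃ κ) (c : Fin 2 → ι → ℂ) : Prop :=
  ∀ w : ℂ, w ≠ 0 → ∀ m m', c 1 m' • E.trans w m m' = c 0 m • F.trans w (e m) (e m')

theorem RelabelCommutes.symm {e : ι ≃ κ} {c : Fin 2 → ι → ℂ} (h : RelabelCommutes E F e c)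
    (hc : ∀ i m, c i m ≠ 0) :
    RelabelCommutes F E e.symm fun i k => (c i (e.symm k))⁻¹ := by
  intro w hw k k'
  have := h w hw (e.symm k) (e.symm k')
  rw [e.apply_symm_apply, e.apply_symm_apply] at this
  rw [inv_smul_eq_iff₀ (hc _ _), smul_comm, this, inv_smul_smul₀ (hc _ _)]

/-- Constants are unaffected by the change of odd coordinates, so the entrywise condition on
matrices passes by linearity to arbitrary components. -/
theorem RelabelCommutes.transport {e : ι ≃ κ} {c : Fin 2 → ι → ℂ} (h : RelabelCommutes E F e c)
    {w : ℂ} (hw : w ≠ 0) (x : ι →₀ Gr) :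
    extend (relabel e (c 1)) (E.transport w x) = F.transport w (extend (relabel e (c 0)) x) := by
  induction x using Finsupp.induction_linear with
  | zero => simp
  | add x y hx hy => simp only [transport_add, map_add, hx, hy]
  | single m a =>
    have h1 : Finsupp.single m a = a • Finsupp.single m (1 : Gr) := by simp
    have h2 : extend (relabel e (c 0)) (Finsupp.single m 1) =
        Finsupp.single (e m) (cst (c 0 m)) := by simp [extend, relabel]
    rw [h1, transport_smul, map_smul, map_smul, transport_smul, transport_single_one, h2,
      transport_single, AlgHom.commutes]
    congr 1
    ext k
    rw [extend_relabel, h w hw, e.apply_symm_apply, Finsupp.smul_apply, Algebra.smul_def,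
      smul_eq_mul]

/-- The map on sections given by relabelling and rescaling. -/
def relabelSec {e : ι ≃ κ} {c : Fin 2 → ι → ℂ} (h : RelabelCommutes E F e c) {U : Opens P1}
    (s : E.Sec U) : F.Sec U :=
  ⟨fun y => extend (relabel e (c y.1.1)) (s.1 y), by
    refine ⟨fun k y => ?_, fun y => ?_, ?_⟩
    · obtain ⟨F, hF, eF⟩ := s.2.1 (e.symm k) y
      refine ⟨fun z => c y.1.1 (e.symm k) • F z, HoloAt.smul analyticAt_const hF, ?_⟩
      filter_upwards [eF] with z hz hU
      rw [extend_relabel, hz hU]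
    · obtain ⟨T, hT⟩ := s.2.2.1 y
      refine ⟨T.map e.toEmbedding, ?_⟩
      filter_upwards [hT] with z hz hU k hk
      rw [Finsupp.mem_support_iff, extend_relabel] at hk
      rw [Finset.mem_map_equiv]
      exact hz hU (Finsupp.mem_support_iff.2 (right_ne_zero_of_smul hk))
    · rintro ⟨⟨_, z⟩, hz⟩ ⟨⟨_, w⟩, hw⟩ h0 h1 h2
      simp only at h0 h1 h2
      subst h0 h1
      have e1 := s.2.2.2 ⟨(0, z), hz⟩ ⟨(1, w), hw⟩ rfl rfl h2
      exact (congrArg (extend (relabel e (c 1))) e1).trans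
        (h.transport (right_ne_zero_of_mul_eq_one h2) _)⟩

theorem relabelSec_apply {e : ι ≃ κ} {c : Fin 2 → ι → ℂ} (h : RelabelCommutes E F e c)
    {U : Opens P1} (s : E.Sec U) (y : Pts U) (k : κ) :
    (relabelSec h s).1 y k = c y.1.1 (e.symm k) • s.1 y (e.symm k) :=
  extend_relabel _ _ _ _

/-- The morphism of sheaves given by relabelling and rescaling. -/
def relabelHom {e : ι ≃ κ} {c : Fin 2 → ι → ℂ} (h : RelabelCommutes E F e c) :
    E.sheaf ⟶ F.sheaf where
  val := PresheafOfModules.homMk (M₁ := E.presheaf) (M₂ := F.presheaf)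
    { app := fun U => AddCommGrpCat.ofHom (X := E.Sec U.unop) (Y := F.Sec U.unop)
        { toFun := relabelSec h
          map_zero' := Subtype.ext (funext fun y => map_zero (extend (relabel e (c y.1.1))))
          map_add' := fun s t => Subtype.ext (funext fun y =>
            map_add (extend (relabel e (c y.1.1))) (s.1 y) (t.1 y)) }
      naturality := fun _ _ _ => rfl }
    (fun U r m => Subtype.ext (funext fun y =>
      map_smul (extend (relabel e (c y.1.1))) ((r : OSec U.unop).1 y) ((m : E.Sec U.unop).1 y)))

theorem onSec_relabelHom {e : ι ≃ κ} {c : Fin 2 → ι → ℂ} (h : RelabelCommutes E F e c)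
    (U : Opens P1) (s : E.Sec U) : onSec (relabelHom h) U s = relabelSec h s := rfl

/-- The isomorphism of sheaves given by relabelling and rescaling by nonzero constants. -/
def relabelIso {e : ι ≃ κ} {c : Fin 2 → ι → ℂ} (h : RelabelCommutes E F e c)
    (hc : ∀ i m, c i m ≠ 0) : E.sheaf ≅ F.sheaf where
  hom := relabelHom h
  inv := relabelHom (h.symm hc)
  hom_inv_id := hom_ext fun U s => by
    change relabelSec (h.symm hc) (relabelSec h s) = s
    refine Subtype.ext (funext fun y => Finsupp.ext fun m => ?_)
    rw [relabelSec_apply, relabelSec_apply]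
    simp [smul_smul, hc]
  inv_hom_id := hom_ext fun U s => by
    change relabelSec h (relabelSec (h.symm hc) s) = s
    refine Subtype.ext (funext fun y => Finsupp.ext fun m => ?_)
    rw [relabelSec_apply, relabelSec_apply]
    simp [smul_smul, hc]

theorem hasParity_relabelHom {e : ι ≃ κ} {c : Fin 2 → ι → ℂ} (h : RelabelCommutes E F e c)
    (hp : ∀ m, F.parity (e m) = E.parity m) : HasParity 0 (relabelHom h) := by
  intro U q s hs y k
  rw [onSec_relabelHom, relabelSec_apply, add_zero]
  obtain ⟨m, rfl⟩ := e.surjective k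
  rw [e.symm_apply_apply, hp]
  exact Submodule.smul_mem _ _ (hs y m)

/-! ### Operators on symbols -/

/-- The target index `m'` is supplied from outside because the operator alone does not show that the
new monomial satisfies `Q`. -/
theorem extend_subMap_slot_single {P Q : FormMono → Prop} {i : Fin 2} {τ : Symb → ℂ × Symb}
    (m : {m // P m}) (m' : {m // Q m}) (a : Gr)
    (h : m'.1 = (m.1.1, Function.update m.1.2 i (τ (m.1.2 i)).2)) :
    extend (subMap (FormMono.slot i τ) P Q) (Finsupp.single m a) =
      Finsupp.single m' (a * cst (τ (m.1.2 i)).1) := by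
  have : subMap (FormMono.slot i τ) P Q m = Finsupp.single m' (τ (m.1.2 i)).1 := by
    ext k
    rw [subMap, Finsupp.subtypeDomain_apply, FormMono.slot, ← h]
    by_cases hk : k = m'
    · rw [hk, Finsupp.single_eq_same, Finsupp.single_eq_same]
    · rw [Finsupp.single_eq_of_ne hk, Finsupp.single_eq_of_ne fun h => hk (Subtype.ext h)]
  simp [extend, this]

theorem extend_subMap_slot_single_eq_zero {P Q : FormMono → Prop} {i : Fin 2}
    {τ : Symb → ℂ × Symb} (m : {m // P m}) (a : Gr) (h : (τ (m.1.2 i)).1 = 0) :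
    extend (subMap (FormMono.slot i τ) P Q) (Finsupp.single m a) = 0 := by
  have : subMap (FormMono.slot i τ) P Q m = 0 := by
    ext k
    simp [subMap, FormMono.slot, h]
  simp [extend, this]

end Frame

/-! ### Parity and splitting of `Θ_max` and `η_max` -/

theorem hasParity_slotMap (i : Fin 2) (τ : Symb → ℂ × Symb) (d k p k' p' : ℤ) (hc hd hk hp)
    (b : ZMod 2) (h : ∀ u, (τ u).1 ≠ 0 → (τ u).2.parity = u.parity + b) :
    Frame.HasParity b (slotMap i τ d k p k' p' hc hd hk hp) := by
  refine Frame.hasParity_ofFrames _ fun m m' hm => ?_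
  have hm' : FormMono.slot i τ m.1 m'.1 ≠ 0 := hm
  obtain ⟨⟨ε, u⟩, hu⟩ := m
  have h1 : m'.1 = (ε, Function.update u i (τ (u i)).2) := by
    by_contra hc
    exact hm' (Finsupp.single_eq_of_ne hc)
  have h2 : (τ (u i)).1 ≠ 0 := by
    intro hc
    exact hm' (by simp [FormMono.slot, hc])
  have h3 := h _ h2
  change allForms.parity m'.1 = allForms.parity (ε, u) + b
  rw [h1]
  fin_cases i
  · change _ = (u 0).parity + b at h3
    simp [allForms, Fin.sum_univ_two] at h3 ⊢
    rw [h3]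
    ring
  · change _ = (u 1).parity + b at h3
    simp [allForms, Fin.sum_univ_two] at h3 ⊢
    rw [h3]
    ring

theorem hasParity_thetaMax (k : ℤ) : Frame.HasParity 0 (thetaMax k) := by
  have h : ∀ u : Symb, u.heaviside.1 ≠ 0 → u.heaviside.2.parity = u.parity + 1 := by
    rintro (a | l) hu
    · exact absurd rfl hu
    · rfl
  -- Each factor exchanges a delta and a power, hence is odd; two odd shifts add up to 0 in `ZMod
  -- 2`.
  exact Frame.HasParity.comp (a := 1) (b := 1)
    (hasParity_slotMap _ _ _ _ _ _ _ _ _ _ _ _ h) (hasParity_slotMap _ _ _ _ _ _ _ _ _ _ _ _ h)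

theorem hasParity_etaMax (k : ℤ) : Frame.HasParity 0 (etaMax k) := by
  have h : ∀ u : Symb, u.eta.1 ≠ 0 → u.eta.2.parity = u.parity + 1 := by
    rintro ((a | l) | l) hu
    · exact absurd rfl hu
    · rfl
    · exact absurd rfl hu
  exact Frame.HasParity.comp (a := 1) (b := 1)
    (hasParity_slotMap _ _ _ _ _ _ _ _ _ _ _ _ h) (hasParity_slotMap _ _ _ _ _ _ _ _ _ _ _ _ h)

/-- By linearity it suffices to follow one frame member, a pair of deltas. The slots are undone in
the reverse order, and in each slot the factorials and signs cancel. -/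
theorem thetaMax_etaMax (k : ℤ) : thetaMax k ≫ etaMax k = 𝟙 _ := by
  refine Frame.hom_ext fun U s => Subtype.ext (funext fun y => ?_)
  change Frame.extend (Frame.subMap (FormMono.slot 0 Symb.eta) _ _)
    (Frame.extend (Frame.subMap (FormMono.slot 1 Symb.eta) _ _)
      (Frame.extend (Frame.subMap (FormMono.slot 1 Symb.heaviside) _ _)
        (Frame.extend (Frame.subMap (FormMono.slot 0 Symb.heaviside) _ _) (s.1 y)))) = s.1 y
  generalize s.1 y = x
  induction x using Finsupp.induction_linear with
  | zero => simp only [map_zero]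
  | add x x' hx hx' => simp only [map_add, hx, hx']
  | single m a =>
    obtain ⟨⟨ε, u⟩, hd, hp⟩ := m
    obtain ⟨l, rfl⟩ : ∃ l : Fin 2 → ℕ, u = _ := exists_delta_of_picture hp
    simp only [FormMono.degree, FormMono.picture, Fin.sum_univ_two, Symb.degree,
      Symb.picture] at hd hp
    -- The exponent produced by `heaviside` must be recognised as `Int.negSucc n`, the case in which
    -- `eta` does not vanish.
    have hn : ∀ n : ℕ, Symb.eta (Symb.pow (-(n : ℤ) - 1)) =
        ((-1 : ℂ) ^ n / n.factorial, Symb.delta n) := by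
      intro n
      have : -(n : ℤ) - 1 = Int.negSucc n := by rw [Int.negSucc_eq]; ring
      rw [this]
      rfl
    have hc : ∀ n : ℕ, ((-1 : ℂ) ^ n * n.factorial) * ((-1) ^ n / n.factorial) = 1 := by
      intro n
      have : (n.factorial : ℂ) ≠ 0 := by exact_mod_cast n.factorial_ne_zero
      have h2 : (-1 : ℂ) ^ n * (-1) ^ n = 1 := by rw [← mul_pow]; simp
      field_simp
      rw [sq, h2]
    rw [Frame.extend_subMap_slot_single _
        ⟨(ε, ![Symb.pow (-(l 0 : ℤ) - 1), Symb.delta (l 1)]), by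
          simp [FormMono.degree, Fin.sum_univ_two, Symb.degree]; linarith, by
          simp [FormMono.picture, Fin.sum_univ_two, Symb.picture]⟩ _
        (Prod.ext rfl (funext fun i => by fin_cases i <;> simp [Symb.heaviside])),
      Frame.extend_subMap_slot_single _
        ⟨(ε, ![Symb.pow (-(l 0 : ℤ) - 1), Symb.pow (-(l 1 : ℤ) - 1)]), by
          simp [FormMono.degree, Fin.sum_univ_two, Symb.degree]; linarith, by
          simp [FormMono.picture, Fin.sum_univ_two, Symb.picture]⟩ _
        (Prod.ext rfl (funext fun i => by fin_cases i <;> simp [Symb.heaviside])),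
      Frame.extend_subMap_slot_single _
        ⟨(ε, ![Symb.pow (-(l 0 : ℤ) - 1), Symb.delta (l 1)]), by
          simp [FormMono.degree, Fin.sum_univ_two, Symb.degree]; linarith, by
          simp [FormMono.picture, Fin.sum_univ_two, Symb.picture]⟩ _
        (Prod.ext rfl (funext fun i => by fin_cases i <;> simp [hn])),
      Frame.extend_subMap_slot_single _ ⟨(ε, fun i => Symb.delta (l i)), by
          simp [FormMono.degree, Fin.sum_univ_two, Symb.degree]; linarith, by
          simp [FormMono.picture, Symb.picture]⟩ _
        (Prod.ext rfl (funext fun i => by fin_cases i <;> simp [hn]))]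
    congr 1
    simp only [Matrix.cons_val_zero, Matrix.cons_val_one, hn, Symb.heaviside]
    rw [mul_assoc a, mul_assoc a, mul_assoc a, ← map_mul, ← map_mul, ← map_mul,
      mul_assoc _ _ ((-1) ^ l 1 / _), hc, mul_one, hc, map_one, mul_one]

/-- A monomorphism with a right inverse is invertible, so `η_max` would be injective on sections
over every open set. But it kills the basic section `dz dθ₁^(k-3) dθ₂⁰`, whose second symbol is a
non-negative power. -/
theorem not_mono_etaMax (k : ℤ) : ¬ Mono (etaMax k) := by
  intro hmono
  have h1 : etaMax k ≫ thetaMax k = 𝟙 _ := by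
    rw [← cancel_mono (etaMax k), Category.assoc, thetaMax_etaMax]
    simp
  let m : {m : FormMono // m.degree = k - 2 ∧ m.picture = 0} :=
    ⟨(true, ![Symb.pow (k - 3), Symb.pow 0]), by
      simp [FormMono.degree, Fin.sum_univ_two, Symb.degree]; ring, by
      simp [FormMono.picture, Symb.picture]⟩
  have hE := forms_regular (k - 2) 0
  have h2 : Frame.onSec (etaMax k) (chartOpen 0) (hE.basic 0 m) = 0 := by
    refine (forms_regular k 2).sec_ext le_rfl fun z hz => ?_
    change Frame.extend (Frame.subMap (FormMono.slot 0 Symb.eta) _ _)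
      (Frame.extend (Frame.subMap (FormMono.slot 1 Symb.eta) _ _)
        ((hE.basic 0 m).1 ⟨(0, z), hz⟩)) = 0
    rw [hE.basic_apply, Frame.extend_subMap_slot_single_eq_zero, map_zero]
    rfl
  refine hE.basic_ne_zero 0 m ?_
  have h3 : Frame.onSec (etaMax k ≫ thetaMax k) (chartOpen 0) (hE.basic 0 m) = hE.basic 0 m := by
    rw [h1]
    rfl
  rw [← h3]
  change Frame.onSec (thetaMax k) _ (Frame.onSec (etaMax k) _ _) = 0
  rw [h2]
  exact map_zero ((thetaMax k).val.app (op (chartOpen 0))).hom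

theorem mono_thetaMax (k : ℤ) : Mono (thetaMax k) :=
  (SplitMono.mk (etaMax k) (thetaMax_etaMax k)).mono

theorem epi_etaMax (k : ℤ) : Epi (etaMax k) :=
  (SplitEpi.mk (thetaMax k) (thetaMax_etaMax k)).epi

/-- Were it epi, its retraction `η_max` would be a two-sided inverse, and so mono. -/
theorem not_epi_thetaMax (k : ℤ) : ¬ Epi (thetaMax k) := by
  intro h
  refine not_mono_etaMax k (SplitMono.mk (thetaMax k) ?_).mono
  rw [← cancel_epi (thetaMax k), ← Category.assoc, thetaMax_etaMax]
  simp

/-! ### Supersymmetric powers of the parity-shifted tangent sheaf -/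

theorem tangent_pi_parity_eq_one {i : Fin 3} : tangent.pi.parity i = 1 ↔ i = 0 := by
  fin_cases i <;> simp [tangent, Frame.pi]

theorem tangent_pi_monoParity (α : Fin 3 → ℕ) : tangent.pi.monoParity α = α 0 := by
  have : (1 + 1 : ZMod 2) = 0 := by decide
  simp [Frame.monoParity, Frame.pi, tangent, Fin.sum_univ_three, this]

/-- After the parity shift `π∂_z` is the only odd generator, so as long as it is not repeated there
is nothing to reorder. -/
theorem tangent_pi_monoSign {α β : Fin 3 → ℕ} (h : α 0 + β 0 ≤ 1) :
    tangent.pi.monoSign α β = 1 := by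
  have h1 : ¬ ∃ i, tangent.pi.parity i = 1 ∧ 2 ≤ α i + β i := by
    rintro ⟨i, hi, hi'⟩
    rw [tangent_pi_parity_eq_one] at hi
    subst hi
    omega
  rw [Frame.monoSign, if_neg h1, Finset.sum_eq_zero, pow_zero]
  refine fun i _ => Finset.sum_eq_zero fun j _ => if_neg ?_
  rintro ⟨hij, hi, hj⟩
  rw [tangent_pi_parity_eq_one] at hi hj
  exact absurd hij (by simp [hi, hj])

/-- A constant right-hand coefficient is even and passes any monomial without a sign. This case
suffices, since the `θ`-dependent coefficients come only from `π∂_z`, which stands leftmost. -/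
theorem tangent_pi_superMul_single {α β : Fin 3 → ℕ} (h : α 0 + β 0 ≤ 1) (a : Gr) (c : ℂ) :
    tangent.pi.superMul (Finsupp.single α a) (Finsupp.single β (cst c)) =
      Finsupp.single (α + β) (a * cst c) := by
  rw [Frame.superMul, Finsupp.sum_single_index (by simp), Finsupp.sum_single_index (by simp),
    tangent_pi_monoSign h, one_smul, AlgHom.commutes, ite_self]

theorem Frame.superMul_add {ι : Type} [Fintype ι] [LinearOrder ι] (E : Frame ι)
    (x y z : (ι → ℕ) →₀ Gr) : E.superMul (x + y) z = E.superMul x z + E.superMul y z := by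
  classical
  refine Finsupp.sum_add_index' (fun α => ?_) fun α a b => ?_
  · simp
  · rw [← Finsupp.sum_add]
    simp only [add_mul, smul_add, Finsupp.single_add]

theorem tangent_pi_superPow {j : Fin 3} (hj : j ≠ 0) (w : ℂ) (l : ℕ) :
    tangent.pi.superPow (Finsupp.single (Pi.single j 1) (cst w)) l =
      Finsupp.single (Pi.single j l) (cst (w ^ l)) := by
  induction l with
  | zero => simp [Frame.superPow]
  | succ l ih =>
    rw [Frame.superPow, ih, tangent_pi_superMul_single (by simp [hj]), ← map_mul, ← Pi.single_add,
      pow_succ', add_comm]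

theorem tangent_pi_trans_zero (w : ℂ) : (tangent.pi.trans w 0).mapDomain
      (fun j : Fin 3 => (Pi.single j 1 : Fin 3 → ℕ)) =
    Finsupp.single (Pi.single 0 1) (cst (-w ^ 2)) +
      (Finsupp.single (Pi.single 1 1) (-(cst w * theta 0)) +
        Finsupp.single (Pi.single 2 1) (-(cst w * theta 1))) := by
  have : tangent.pi.trans w 0 = Finsupp.single 0 (cst (-w ^ 2)) +
      (Finsupp.single 1 (-(cst w * theta 0)) + Finsupp.single 2 (-(cst w * theta 1))) := by
    simp [tangent, Frame.pi, Fin.sum_univ_two, sub_eq_add_neg]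
    abel
  rw [this]
  simp only [Finsupp.mapDomain_add, Finsupp.mapDomain_single]

theorem tangent_pi_trans_ne_zero (w : ℂ) {j : Fin 3} (hj : j ≠ 0) :
    (tangent.pi.trans w j).mapDomain (fun j : Fin 3 => (Pi.single j 1 : Fin 3 → ℕ)) =
      Finsupp.single (Pi.single j 1) (cst w) := by
  simp [tangent, Frame.pi, hj]

/-- The even generators are merely rescaled by `w`, so together they contribute a single monomial;
only the power of `π∂_z` has to be expanded. -/
theorem tangent_pi_monoTrans (w : ℂ) (a b c : ℕ) : tangent.pi.monoTrans w ![a, b, c] =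
    tangent.pi.superMul (tangent.pi.superPow ((tangent.pi.trans w 0).mapDomain
      fun j : Fin 3 => (Pi.single j 1 : Fin 3 → ℕ)) a)
      (Finsupp.single ![0, b, c] (cst (w ^ (b + c)))) := by
  have hs : (Finset.univ : Finset (Fin 3)).sort (· ≤ ·) = [0, 1, 2] := by
    rw [Fin.sort_univ]
    rfl
  have hv : (Pi.single 1 (![a, b, c] 1) + Pi.single 2 (![a, b, c] 2) : Fin 3 → ℕ) =
      ![0, b, c] := by
    funext i
    fin_cases i <;> simp
  rw [Frame.monoTrans, hs]
  simp only [List.foldr]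
  rw [tangent_pi_trans_ne_zero w (j := 1) (by decide),
    tangent_pi_trans_ne_zero w (j := 2) (by decide), tangent_pi_superPow (by decide),
    tangent_pi_superPow (by decide), ← map_one cst, tangent_pi_superMul_single (by simp),
    map_one, mul_one, add_zero, tangent_pi_superMul_single (by simp), ← map_mul, ← pow_add, hv]
  rfl

theorem tangent_pi_monoTrans_zero (w : ℂ) (b c : ℕ) : tangent.pi.monoTrans w ![0, b, c] =
    Finsupp.single ![0, b, c] (cst (w ^ (b + c))) := by
  rw [tangent_pi_monoTrans, Frame.superPow, tangent_pi_superMul_single (by simp), one_mul, zero_add]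

theorem tangent_pi_monoTrans_one (w : ℂ) (b c : ℕ) : tangent.pi.monoTrans w ![1, b, c] =
    Finsupp.single ![1, b, c] (cst (-w ^ (b + c + 2))) +
      (Finsupp.single ![0, b + 1, c] (-(cst (w ^ (b + c + 1)) * theta 0)) +
        Finsupp.single ![0, b, c + 1] (-(cst (w ^ (b + c + 1)) * theta 1))) := by
  have h0 : (Pi.single 0 1 + ![0, b, c] : Fin 3 → ℕ) = ![1, b, c] := by
    funext i; fin_cases i <;> simp
  have h1 : (Pi.single 1 1 + ![0, b, c] : Fin 3 → ℕ) = ![0, b + 1, c] := by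
    funext i; fin_cases i <;> simp [add_comm]
  have h2 : (Pi.single 2 1 + ![0, b, c] : Fin 3 → ℕ) = ![0, b, c + 1] := by
    funext i; fin_cases i <;> simp [add_comm]
  have hθ : ∀ i : Fin 2, -(cst w * theta i) * cst (w ^ (b + c)) =
      -(cst (w ^ (b + c + 1)) * theta i) := by
    intro i
    rw [neg_mul, mul_assoc, theta_mul_cst, ← mul_assoc, ← map_mul, pow_succ']
  -- The first power is defined as a product with 1; that 1 acts trivially is checked on the three
  -- terms of the chain rule.
  have hm : ∀ x : (Fin 3 → ℕ) →₀ Gr,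
      x = Finsupp.single (Pi.single 0 1) (cst (-w ^ 2)) +
        (Finsupp.single (Pi.single 1 1) (-(cst w * theta 0)) +
          Finsupp.single (Pi.single 2 1) (-(cst w * theta 1))) →
      tangent.pi.superPow x 1 = x := by
    rintro x rfl
    rw [Frame.superPow, Frame.superPow, Frame.superMul_add, Frame.superMul_add, ← map_one cst,
      tangent_pi_superMul_single (by simp), tangent_pi_superMul_single (by simp),
      tangent_pi_superMul_single (by simp)]
    simp only [map_one, mul_one, add_zero]
  rw [tangent_pi_monoTrans, hm _ (tangent_pi_trans_zero w), tangent_pi_trans_zero,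
    Frame.superMul_add, Frame.superMul_add, tangent_pi_superMul_single (by simp),
    tangent_pi_superMul_single (by simp), tangent_pi_superMul_single (by simp), h0, h1, h2, hθ, hθ,
    ← map_mul]
  congr 3
  ring

/-! ### The isomorphism with the integral forms -/

/-- The integral form that corresponds to a monomial in `π∂_z, π∂_θ₁, π∂_θ₂`. -/
def formOf (α : Fin 3 → ℕ) : FormMono :=
  (decide (α 0 = 0), fun i => Symb.delta (α i.succ))

/-- The form records only whether the exponent of `π∂_z` vanishes, which determines it because it is
at most 1. -/
theorem formOf_injOn {α β : Fin 3 → ℕ} (hα : α 0 ≤ 1) (hβ : β 0 ≤ 1)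
    (h : formOf α = formOf β) : α = β := by
  have h1 := congrArg Prod.fst h
  have h2 := congrFun (congrArg Prod.snd h)
  simp only [formOf, decide_eq_decide, Symb.delta.injEq] at h1 h2
  funext i
  refine Fin.cases ?_ h2 i
  omega

/-- The monomials that form the frame of `Symⁿ Π𝒯`. -/
abbrev SymIndex (n : ℕ) : Type :=
  {α : Fin 3 → ℕ // ∑ i, α i = n ∧ ∀ i, tangent.pi.parity i = 1 → α i ≤ 1}

theorem SymIndex.le_one {n : ℕ} (α : SymIndex n) : α.1 0 ≤ 1 :=
  α.2.2 0 (tangent_pi_parity_eq_one.2 rfl)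

theorem formOf_bidegree {k : ℤ} (hk : k ≤ 1) (α : SymIndex (k - 1).natAbs) :
    (formOf α.1).degree = k ∧ (formOf α.1).picture = 2 := by
  have h1 := α.le_one
  have h2 := α.2.1
  rw [Fin.sum_univ_three] at h2
  refine ⟨?_, by simp [formOf, FormMono.picture, Symb.picture]⟩
  simp only [formOf, FormMono.degree, Fin.sum_univ_two, Symb.degree, decide_eq_true_eq]
  change (if α.1 0 = 0 then (1 : ℤ) else 0) + (-(α.1 1 : ℤ) + -(α.1 2 : ℤ)) = k
  split_ifs <;> omega

/-- The monomials in `π∂_z, π∂_θ₁, π∂_θ₂` correspond to the integral forms. -/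
def formEquiv {k : ℤ} (hk : k ≤ 1) :
    SymIndex (k - 1).natAbs ≃ {m : FormMono // m.degree = k ∧ m.picture = 2} :=
  Equiv.ofBijective (fun α => ⟨formOf α.1, formOf_bidegree hk α⟩) (by
    constructor
    · intro α β h
      exact Subtype.ext (formOf_injOn α.le_one β.le_one (congrArg Subtype.val h))
    · rintro ⟨⟨ε, u⟩, hd, hp⟩
      obtain ⟨l, rfl⟩ : ∃ l : Fin 2 → ℕ, u = _ := exists_delta_of_picture hp
      simp only [FormMono.degree, Fin.sum_univ_two, Symb.degree] at hd
      -- The preimage contains `π∂_z` exactly when `dz` is absent, and takes the orders of the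
      -- deltas as even exponents.
      refine ⟨⟨![if ε then 0 else 1, l 0, l 1], ?_, fun i hi => ?_⟩, Subtype.ext (Prod.ext ?_ ?_)⟩
      · rw [Fin.sum_univ_three]
        simp only [Matrix.cons_val_zero, Matrix.cons_val_one, Matrix.cons_val]
        cases ε <;> simp at hd ⊢ <;> omega
      · rw [tangent_pi_parity_eq_one] at hi
        subst hi
        cases ε <;> simp
      · cases ε <;> simp [formOf]
      · funext i
        fin_cases i <;> simp [formOf])

/-- The constants of the isomorphism. -/
def formSign (i : Fin 2) (b : Bool) : ℂ := if i = 1 ↔ b = true then 1 else -1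

theorem formSign_ne_zero (i : Fin 2) (b : Bool) : formSign i b ≠ 0 := by
  unfold formSign
  split_ifs <;> simp

/-- Carries single terms from monomials to forms, so that both transition matrices can be compared
in one frame. -/
theorem smul_single_apply (f : Bool → ℂ) {α β : Fin 3 → ℕ} (hα : α 0 ≤ 1) (hβ : β 0 ≤ 1) (a : Gr) :
    f (formOf β).1 • Finsupp.single α a β =
      Finsupp.single (formOf α) (f (formOf α).1 • a) (formOf β) := by
  by_cases h : β = α
  · subst h
    simp
  · rw [Finsupp.single_eq_of_ne h, smul_zero,
      Finsupp.single_eq_of_ne fun h' => h (formOf_injOn hβ hα h')]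

/-- The weight of a pair of deltas is `b + c + 2`. The diagonal entries are `w^(b+c)` against
`-w^(b+c)` for `a = 0`, and `-w^(b+c+2)` against `w^(b+c+2)` for `a = 1`, so each type must change
sign between the charts. The off-diagonal entries `-w^(b+c+1) θᵢ` agree, which ties the constant of
the `dz` type in `U₁` to that of the other type in `U₀`. -/
theorem smul_monoTrans_apply {a : ℕ} (ha : a ≤ 1) (b c : ℕ) {β : Fin 3 → ℕ} (hβ : β 0 ≤ 1) {w : ℂ} :
    formSign 1 (formOf β).1 • tangent.pi.monoTrans w ![a, b, c] β =
      formSign 0 (formOf ![a, b, c]).1 • allForms.trans w (formOf ![a, b, c]) (formOf β) := by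
  have e0 : ∀ b c, formOf ![0, b, c] = (true, ![Symb.delta b, Symb.delta c]) := fun b c =>
    Prod.ext rfl (funext fun i => by fin_cases i <;> rfl)
  have e1 : formOf ![1, b, c] = (false, ![Symb.delta b, Symb.delta c]) :=
    Prod.ext rfl (funext fun i => by fin_cases i <;> rfl)
  have s00 : formSign 0 false = 1 := by simp [formSign]
  have s01 : formSign 0 true = -1 := by simp [formSign]
  have s10 : formSign 1 false = -1 := by simp [formSign]
  have s11 : formSign 1 true = 1 := by simp [formSign]
  have hW : ∀ ε : Bool, FormMono.weight (ε, ![Symb.delta b, Symb.delta c]) =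
      ((b + c + 2 : ℕ) : ℤ) := by
    intro ε
    simp [FormMono.weight, Fin.sum_univ_two, Symb.weight]
    ring
  have h2 : ((b + c + 2 : ℕ) : ℤ) - 2 = (b + c : ℕ) := by push_cast; ring
  have h1 : ((b + c + 2 : ℕ) : ℤ) - 1 = (b + c + 1 : ℕ) := by push_cast; ring
  interval_cases a
  · rw [tangent_pi_monoTrans_zero, smul_single_apply (formSign 1) (by simp) hβ, e0,
      allForms_trans_true, hW, h2, zpow_natCast, s01, s11, ← Finsupp.smul_apply,
      Finsupp.smul_single, one_smul, map_neg, smul_neg, neg_smul, one_smul, neg_neg]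
  · have u0 : Function.update ![Symb.delta b, Symb.delta c] 0 (Symb.delta (b + 1)) =
        ![Symb.delta (b + 1), Symb.delta c] := by
      funext i
      fin_cases i <;> rfl
    have u1 : Function.update ![Symb.delta b, Symb.delta c] 1 (Symb.delta (c + 1)) =
        ![Symb.delta b, Symb.delta (c + 1)] := by
      funext i
      fin_cases i <;> rfl
    rw [tangent_pi_monoTrans_one, Finsupp.add_apply, Finsupp.add_apply, smul_add, smul_add,
      smul_single_apply (formSign 1) (by simp) hβ, smul_single_apply (formSign 1) (by simp) hβ,
      smul_single_apply (formSign 1) (by simp) hβ, e0, e0, e1, allForms_trans_false, hW, h1,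
      zpow_natCast, zpow_natCast, s00, s10, s11, Fin.sum_univ_two]
    simp only [Matrix.cons_val_zero, Matrix.cons_val_one, Symb.deriv, u0, u1, one_smul, neg_smul,
      map_neg, neg_neg, one_mul, Finsupp.single_neg, Finsupp.sub_apply, Finsupp.add_apply,
      Finsupp.neg_apply]
    abel

theorem relabelCommutes_formEquiv {k : ℤ} (hk : k ≤ 1) :
    Frame.RelabelCommutes (piSymPiT (k - 1).natAbs) (forms k 2) (formEquiv hk)
      fun i α => formSign i (formOf α.1).1 := by
  intro w _ α β
  have h := smul_monoTrans_apply (w := w) (SymIndex.le_one α) (α.1 1) (α.1 2) (SymIndex.le_one β)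
  have hv : ![α.1 0, α.1 1, α.1 2] = α.1 := by
    funext i
    fin_cases i <;> rfl
  rw [hv] at h
  exact h

theorem piSymPiT_parity {k : ℤ} (hk : k ≤ 1) (α : SymIndex (k - 1).natAbs) :
    (forms k 2).parity (formEquiv hk α) = (piSymPiT (k - 1).natAbs).parity α := by
  have h1 : allForms.parity (formOf α.1) = tangent.pi.monoParity α.1 + 1 := by
    rw [tangent_pi_monoParity]
    have : (1 + 1 : ZMod 2) = 0 := by decide
    have h0 : α.1 0 = 0 ∨ α.1 0 = 1 := by have := α.le_one; omega
    rcases h0 with h0 | h0 <;>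
      simp [allForms, formOf, h0, Fin.sum_univ_two, Symb.parity, this]
  exact h1

/-- The isomorphism of `Π Symⁿ Π𝒯` with the integral forms of degree `1 - n`. -/
def integralFormsIso {k : ℤ} (hk : k ≤ 1) :
    (piSymPiT (k - 1).natAbs).sheaf ≅ (forms k 2).sheaf :=
  Frame.relabelIso (relabelCommutes_formEquiv hk) fun _ _ => formSign_ne_zero _ _

end SuperP12

end

open SuperP12 SuperP12.Frame in
theorem mainTheorem9 (k : ℤ) :
    (k ≤ 1 →
      IsLocallyFreeOfRank (forms k 2) (1 - k).toNat (2 - k).toNat ∧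
      ∃ Φ : (piSymPiT (k - 1).natAbs).sheaf ≅ (forms k 2).sheaf,
        HasParity 0 Φ.hom ∧
        (∃ c : Fin 2 → Bool → ℂ, (∀ i b, c i b ≠ 0) ∧
          ∀ U s y m α, m.1 = (decide (α.1 0 = 0), fun i => Symb.delta (α.1 i.succ)) →
            (onSec Φ.hom U s).1 y m = c y.1.1 m.1.1 • s.1 y α) ∧
        Mono (Φ.hom ≫ thetaMax k)) ∧
    (∀ x, ¬ IsFiniteTypeAt (forms (k - 2) 0) x) ∧
    HasParity 0 (thetaMax k) ∧ Mono (thetaMax k) ∧ ¬ Epi (thetaMax k) ∧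
    HasParity 0 (etaMax k) ∧ Epi (etaMax k) ∧ ¬ Mono (etaMax k) ∧
    thetaMax k ≫ etaMax k ≫ thetaMax k = thetaMax k ∧
    ∃ e : cokernel (thetaMax k) ≅ kernel (etaMax k),
      e.inv = kernel.ι (etaMax k) ≫ cokernel.π (thetaMax k) := by
  refine ⟨fun hk => ⟨isLocallyFreeOfRank_integralForms k hk, integralFormsIso hk,
    hasParity_relabelHom _ (piSymPiT_parity hk), ⟨formSign, formSign_ne_zero, ?_⟩, ?_⟩,
    (forms_regular _ _).not_isFiniteTypeAt, hasParity_thetaMax k, mono_thetaMax k,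
    not_epi_thetaMax k, hasParity_etaMax k, epi_etaMax k, not_mono_etaMax k, ?_,
    exists_cokernel_iso_kernel (thetaMax_etaMax k)⟩
  · intro U s y m α h
    obtain rfl : m = formEquiv hk α := Subtype.ext h
    change (relabelSec (relabelCommutes_formEquiv hk) s).1 y _ = _
    rw [relabelSec_apply, Equiv.symm_apply_apply]
    rfl
  · have := mono_thetaMax k
    exact mono_comp _ _
  · rw [← Category.assoc, thetaMax_etaMax, Category.id_comp]
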